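/- **Setting.** A user is located at the origin of $\mathbb R^2$. HAPs at height $H_{\rm HAP}$ and RISs at height $H_{\rm RIS}$, $0<H_{\rm RIS}<H_{\rm HAP}$, form homogeneous Poisson point processes of densities $\lambda_{\rm HAP}>0$ and $\mu_{\rm RIS}>0$. Buildings form a Boolean model: their centres are a homogeneous Poisson process of density $\lambda_B>0$, and they are rectangles with independent positive lengths and widths of finite means $\mathbb E[\mathsf L],\mathbb E[\mathsf W]$ and independent orientations uniform on $(0,2\pi]$. An RIS at $x\in\mathbb R^2$ is visible with the probability that no building meets the segment $[0,x]$, independently for different RISs. Let $\omega_g$ be the distance from the origin to the nearest visible RIS ($\omega_g=\infty$ if there is none), and let $\omega_q$ and $\omega_u$ be the horizontal distances of the HAP--RIS and HAP--user links, each being the distance from the origin to the nearest point of a homogeneous Poisson process of density $\lambda_{\rm HAP}$ (the HAPs as seen from the RIS and from the user). Put $$R_q=\sqrt{\omega_q^2+(H_{\rm HAP}-H_{\rm RIS})^2},\quad R_g=\sqrt{\omega_g^2+H_{\rm RIS}^2},\quad R_u=\sqrt{\omega_u^2+H_{\rm HAP}^2}.$$ Let $q_l,g_l$ ($1\le l\le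 L$) and $u$ be complex fading coefficients whose moduli have $\kappa$--$\mu$ distributions of unit mean square, with parameters $(\kappa_q,\mu_q)$, $(\kappa_g,\mu_g)$, $(\kappa_u,\mu_u)$, where $\kappa\ge0$ and $\mu>0$. All of $|q_l|,|g_l|,|u|,\omega_q,\omega_g,\omega_u$ are mutually independent. With path-loss exponents $\epsilon,\varepsilon,\varrho>0$ and phase shifts $\zeta_l=e^{j\theta_l}$, $\theta_l=\angle u-(\angle q_l+\angle g_l)$, let $$A=\frac{\sum_{l=1}^L q_l g_l\zeta_l}{R_q^{\epsilon/2}R_g^{\varepsilon/2}}+\frac{u}{R_u^{\varrho/2}},\qquad \rho=\rho_0|A|^2,\qquad \rho_0=E_s/N_0>0,$$ where the first term is $0$ if $R_g=\infty$. **Notation.** $\Gamma(\cdot,\cdot)$ is the upper incomplete Gamma function, and $$m(\kappa,\mu)=\frac{\Gamma(\mu+\frac12)e^{-\kappa\mu}}{\Gamma(\mu)((1+\kappa)\mu)^{1/2}}\,{}_1F_1(\mu+\tfrac12;\mu;\kappa\mu),$$ $$h_t(\eta,H)=(\pi\lambda_{\rm HAP})^{\eta t/4}e^{\pi H^2\lambda_{\rm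 HAP}}\,\Gamma\!\left(1-\tfrac{\eta t}4,\,H^2\lambda_{\rm HAP}\pi\right),$$ $$r_t=2\pi\mu_{\rm RIS}e^{-p}\int_0^\infty (w^2+H_{\rm RIS}^2)^{-t\varepsilon/4}\,w\,\exp\!\Big(-\Upsilon w-2\pi\mu_{\rm RIS}\tfrac{e^{-p}}{\Upsilon^2}\big(1-(\Upsilon w+1)e^{-\Upsilon w}\big)\Big)dw,$$ with $\Upsilon=2\lambda_B(\mathbb E[\mathsf L]+\mathbb E[\mathsf W])/\pi$ and $p=\lambda_B\mathbb E[\mathsf L]\mathbb E[\mathsf W]$. **Claim.** 1. $\mathbb E[|A|^2]<\infty$, and $$\mathbb E[|A|]=P_1+P_2,\qquad P_1=L\,m(\kappa_q,\mu_q)\,m(\kappa_g,\mu_g)\,h_1(\epsilon,H_{\rm HAP}-H_{\rm RIS})\,r_1,\qquad P_2=h_1(\varrho,H_{\rm HAP})\,m(\kappa_u,\mu_u),$$ $$\mathrm{Var}[|A|]=\Big[\big((L^2-L)\,m(\kappa_q,\mu_q)^2m(\kappa_g,\mu_g)^2+L\big)\,h_2(\epsilon,H_{\rm HAP}-H_{\rm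 RIS})\,r_2-P_1^2\Big]+\Big[h_2(\varrho,H_{\rm HAP})-P_2^2\Big].$$ Both numbers are positive. 2. $|A|$ and $\rho$ have densities, and $f_\rho(x)=\frac1{2\sqrt{\rho_0x}}\,f_{|A|}\big(\sqrt{x/\rho_0}\big)$ for almost every $x>0$. 3. Let $\alpha=\mathbb E[|A|]^2/\mathrm{Var}[|A|]$ and $\beta=\mathrm{Var}[|A|]/\mathbb E[|A|]$. The Gamma law with shape $\alpha$ and scale $\beta$ has the mean and the variance of $|A|$. Its density $\frac{y^{\alpha-1}}{\beta^\alpha\Gamma(\alpha)}e^{-y/\beta}$ ($y>0$) is the term $k=0$ of the Laguerre series $$f_{|A|}(y)\sim\frac{y^{\alpha-1}e^{-y/\beta}}{\beta^\alpha\Gamma(\alpha)}\sum_{k\ge0}c_k\,L_k^{(\alpha-1)}(y/\beta),\qquad c_k=\frac{k!\,\Gamma(\alpha)}{\Gamma(k+\alpha)}\,\mathbb E\big[L_k^{(\alpha-1)}(|A|/\beta)\big],$$ and the terms $k=1$ and $k=2$ vanish. Replacing $f_{|A|}$ by this Gamma density in the relation of part 2 gives the approximating SNR density $$\tilde f_\rho(x)=\frac{1}{2\beta^\alpha\Gamma(\alpha)}\,\rho_0^{-\alpha/2}\,x^{(\alpha-2)/2}\exp\!\Big(-\sqrt{\tfrac{x}{\beta^2\rho_0}}\Big),\qquad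 x>0,$$ which is the probability density of $\rho_0Y^2$ for $Y$ with that Gamma law. -/

import Mathlib

open MeasureTheory ProbabilityTheory Set
open scoped ENNReal NNReal

namespace HapRis

noncomputable section

/-! ### Special functions -/

/-- Upper incomplete Gamma function `Γ(s, z) = ∫_z^∞ t^(s-1) e^(-t) dt`. -/
def upperGamma (s z : ℝ) : ℝ := ∫ t in Ioi z, t ^ (s - 1) * Real.exp (-t)

/-- Kummer's confluent hypergeometric function `₁F₁(a; b; z)`. -/
def kummer (a b z : ℝ) : ℝ :=
  ∑' n : ℕ, (ascPochhammer ℝ n).eval a / (ascPochhammer ℝ n).eval b * z ^ n / (n.factorial : ℝ)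

/-- Modified Bessel function of the first kind `I_ν(z)`, for `z ≥ 0`. -/
def besselI (ν z : ℝ) : ℝ :=
  ∑' n : ℕ, (z / 2) ^ (2 * (n : ℝ) + ν) / ((n.factorial : ℝ) * Real.Gamma ((n : ℝ) + ν + 1))

/-- Generalized Laguerre polynomial `L_k^(a)(x)`, for `a > -1`. -/
def laguerre (k : ℕ) (a x : ℝ) : ℝ :=
  ∑ i ∈ Finset.range (k + 1),
    (-1) ^ i * Real.Gamma ((k : ℝ) + a + 1) /
      (Real.Gamma ((i : ℝ) + a + 1) * ((k - i).factorial : ℝ)) * x ^ i / (i.factorial : ℝ)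

/-! ### The `κ`-`μ` distribution -/

/-- Density on `(0, ∞)` of the `κ`-`μ` envelope of unit mean power; for `κ = 0` this is the
limiting (Nakagami) density. -/
def kappaMuPDF (κ μ r : ℝ) : ℝ :=
  if κ = 0 then 2 * μ ^ μ / Real.Gamma μ * r ^ (2 * μ - 1) * Real.exp (-(μ * r ^ 2))
  else 2 * μ * (1 + κ) ^ ((μ + 1) / 2) / (κ ^ ((μ - 1) / 2) * Real.exp (μ * κ)) * r ^ μ *
    Real.exp (-(μ * (1 + κ) * r ^ 2)) * besselI (μ - 1) (2 * μ * √(κ * (1 + κ)) * r)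

def kappaMuMeasure (κ μ : ℝ) : Measure ℝ :=
  (volume.restrict (Ioi 0)).withDensity fun r => ENNReal.ofReal (kappaMuPDF κ μ r)

/-- `Γ(μ+1/2) e^(-κμ) / (Γ(μ) ((1+κ)μ)^(1/2)) · ₁F₁(μ+1/2; μ; κμ)`. -/
def kappaMuMean (κ μ : ℝ) : ℝ :=
  Real.Gamma (μ + 1 / 2) * Real.exp (-(κ * μ)) / (Real.Gamma μ * ((1 + κ) * μ) ^ (1 / 2 : ℝ)) *
    kummer (μ + 1 / 2) μ (κ * μ)

/-! ### Point processes -/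

/-- The random set `Φ` is a (simple) Poisson point process with intensity measure `ν`: the numbers
of points in disjoint measurable sets are independent, and the number of points in a set `B` of
finite `ν`-measure has the Poisson law with parameter `ν B`. -/
structure IsPoissonProcess {Ω X : Type*} [MeasurableSpace Ω] [MeasurableSpace X]
    (Φ : Ω → Set X) (ν : Measure X) (P : Measure Ω) : Prop where
  measurable_count : ∀ B, MeasurableSet B → Measurable fun ω => (Φ ω ∩ B).encard
  count_law : ∀ B, MeasurableSet B → ν B ≠ ∞ →
    P.map (fun ω => (Φ ω ∩ B).encard) =
      (poissonMeasure (ν B).toNNReal).map (fun n : ℕ => (n : ℕ∞))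
  indep : ∀ (n : ℕ) (B : Fin n → Set X), (∀ i, MeasurableSet (B i)) →
    Pairwise (fun i j => Disjoint (B i) (B j)) → iIndepFun (fun i ω => (Φ ω ∩ B i).encard) P

/-- The horizontal plane; the user is at the origin. -/
abbrev Plane : Type := EuclideanSpace ℝ (Fin 2)

/-- A building: centre, length, width, orientation. -/
abbrev Building : Type := Plane × ℝ × ℝ × ℝ

/-- The rectangle occupied by a building: sides of length `l` in the direction
`(cos θ, sin θ)` and `w` in the orthogonal direction. -/
def footprint (b : Building) : Set Plane :=
  {x | |Real.cos b.2.2.2 * (x 0 - b.1 0) + Real.sin b.2.2.2 * (x 1 - b.1 1)| ≤ b.2.1 / 2 ∧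
    |-Real.sin b.2.2.2 * (x 0 - b.1 0) + Real.cos b.2.2.2 * (x 1 - b.1 1)| ≤ b.2.2.1 / 2}

/-- Distance from the user (the origin) to the nearest point of `S`; it is `∞` if `S` is empty. -/
def nearest (S : Set Plane) : ℝ≥0∞ := ⨅ x ∈ S, ‖x‖ₑ

/-- Diagonal distance `√(ω² + H²)`. -/
def diagonal (ω : ℝ≥0∞) (H : ℝ) : ℝ≥0∞ := (ω ^ 2 + ENNReal.ofReal (H ^ 2)) ^ (1 / 2 : ℝ)

/-- `R^(-η/2)`, which is `0` for `R = ∞` and `η > 0`. -/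
def pathGain (η : ℝ) (R : ℝ≥0∞) : ℝ := (R ^ (-(η / 2))).toReal

/-! ### The network -/

/-- Deterministic parameters. -/
structure Params where
  /-- number of reflecting elements -/
  L : ℕ
  /-- density of the HAPs -/
  lamHAP : ℝ
  /-- density of the RISs -/
  muRIS : ℝ
  /-- density of the building centres -/
  lamB : ℝ
  /-- heights of the HAPs and of the RISs -/
  heightHAP : ℝ
  heightRIS : ℝ
  /-- path-loss exponents of the HAP-RIS, RIS-user and HAP-user links -/
  expQ : ℝ
  expG : ℝ
  expU : ℝ
  /-- fading parameters of the HAP-RIS, RIS-user and HAP-user links -/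
  κq : ℝ
  μq : ℝ
  κg : ℝ
  μg : ℝ
  κu : ℝ
  μu : ℝ
  /-- laws of the lengths and of the widths of the buildings -/
  lenLaw : Measure ℝ
  widLaw : Measure ℝ
  /-- symbol energy and noise variance -/
  Es : ℝ
  N0 : ℝ

structure Params.Admissible (p : Params) : Prop where
  lamHAP_pos : 0 < p.lamHAP
  muRIS_pos : 0 < p.muRIS
  lamB_pos : 0 < p.lamB
  heightRIS_pos : 0 < p.heightRIS
  height_lt : p.heightRIS < p.heightHAP
  expQ_pos : 0 < p.expQ
  expG_pos : 0 < p.expG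
  expU_pos : 0 < p.expU
  κq_nonneg : 0 ≤ p.κq
  μq_pos : 0 < p.μq
  κg_nonneg : 0 ≤ p.κg
  μg_pos : 0 < p.μg
  κu_nonneg : 0 ≤ p.κu
  μu_pos : 0 < p.μu
  lenLaw_prob : IsProbabilityMeasure p.lenLaw
  widLaw_prob : IsProbabilityMeasure p.widLaw
  lenLaw_pos : ∀ᵐ x ∂p.lenLaw, 0 < x
  widLaw_pos : ∀ᵐ x ∂p.widLaw, 0 < x
  lenLaw_integrable : Integrable id p.lenLaw
  widLaw_integrable : Integrable id p.widLaw
  Es_pos : 0 < p.Es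
  N0_pos : 0 < p.N0

namespace Params

variable (p : Params)

/-- Transmit signal-to-noise ratio. -/
def ρ₀ : ℝ := p.Es / p.N0

/-- Mean length and mean width of a building. -/
def meanLen : ℝ := ∫ x, x ∂p.lenLaw

def meanWid : ℝ := ∫ x, x ∂p.widLaw

/-- `Υ = 2 λ_B (E[L] + E[W]) / π`. -/
def upsilon : ℝ := 2 * p.lamB * (p.meanLen + p.meanWid) / Real.pi

/-- `p = λ_B E[L] E[W]`. -/
def pB : ℝ := p.lamB * p.meanLen * p.meanWid

/-- Formula for the `t`-th moment of `R_g^(-ε_g/2)`. -/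
def risMoment (t : ℝ) : ℝ :=
  2 * Real.pi * p.muRIS * Real.exp (-p.pB) *
    ∫ w in Ioi (0 : ℝ), (w ^ 2 + p.heightRIS ^ 2) ^ (-(t * p.expG / 4)) * w *
      Real.exp (-(p.upsilon * w + 2 * Real.pi * p.muRIS * (Real.exp (-p.pB) / p.upsilon ^ 2) *
        (1 - (p.upsilon * w + 1) * Real.exp (-(p.upsilon * w)))))

/-- Formula for the `t`-th moment of `R^(-η/2)`, for a link of vertical distance `H` to a HAP. -/
def hapMoment (η H t : ℝ) : ℝ :=
  (Real.pi * p.lamHAP) ^ (η * t / 4) * Real.exp (Real.pi * H ^ 2 * p.lamHAP) *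
    upperGamma (1 - η * t / 4) (H ^ 2 * p.lamHAP * Real.pi)

/-- The summands `P₁`, `P₂` of the formula for the mean. -/
def P1 : ℝ :=
  p.L * kappaMuMean p.κq p.μq * kappaMuMean p.κg p.μg *
    p.hapMoment p.expQ (p.heightHAP - p.heightRIS) 1 * p.risMoment 1

def P2 : ℝ := p.hapMoment p.expU p.heightHAP 1 * kappaMuMean p.κu p.μu

/-- Formula for the variance. -/
def varFormula : ℝ :=
  ((((p.L : ℝ) ^ 2 - p.L) * kappaMuMean p.κq p.μq ^ 2 * kappaMuMean p.κg p.μg ^ 2 + p.L) *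
      p.hapMoment p.expQ (p.heightHAP - p.heightRIS) 2 * p.risMoment 2 - p.P1 ^ 2) +
    (p.hapMoment p.expU p.heightHAP 2 - p.P2 ^ 2)

/-- Intensity measures of the HAPs, of the buildings, and of the RISs. Every RIS carries an
independent mark, uniform on `[0, 1]`, which decides whether it is visible. -/
def hapIntensity : Measure Plane := ENNReal.ofReal p.lamHAP • volume

def buildingIntensity : Measure Building :=
  ENNReal.ofReal p.lamB • (volume : Measure Plane).prod
    (p.lenLaw.prod (p.widLaw.prod (ProbabilityTheory.cond volume (Ioc 0 (2 * Real.pi)))))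

def risIntensity : Measure (Plane × ℝ) :=
  ENNReal.ofReal p.muRIS • (volume : Measure Plane).prod (volume.restrict (Icc 0 1))

end Params

/-- The random objects: HAP positions relative to the serving RIS and relative to the user, the
marked RISs, the buildings, and the fading coefficients. -/
structure Network (p : Params) (Ω : Type*) where
  hapQ : Ω → Set Plane
  hapU : Ω → Set Plane
  ris : Ω → Set (Plane × ℝ)
  buildings : Ω → Set Building
  q : Fin p.L → Ω → ℂ
  g : Fin p.L → Ω → ℂ
  u : Ω → ℂ

/-- Labels of the sources of randomness in the channel. -/
inductive Source (L : ℕ) where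
  | q (l : Fin L)
  | g (l : Fin L)
  | u
  | distQ
  | distG
  | distU

namespace Network

variable {p : Params} {Ω : Type*} [MeasurableSpace Ω] (N : Network p Ω) (P : Measure Ω)

/-- Probability that no building meets the segment from the user to `x`. -/
def visProb (x : Plane) : ℝ :=
  P.real {ω | ∀ b ∈ N.buildings ω, Disjoint (footprint b) (segment ℝ 0 x)}

/-- The visible RISs: an RIS at `x` is visible with probability `visProb x`, independently of the
other RISs. -/
def visibleRIS (ω : Ω) : Set Plane := {x | ∃ m, (x, m) ∈ N.ris ω ∧ m ≤ N.visProb P x}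

/-- Horizontal distances of the HAP-RIS, RIS-user and HAP-user links. -/
def distQ (ω : Ω) : ℝ≥0∞ := nearest (N.hapQ ω)

def distG (ω : Ω) : ℝ≥0∞ := nearest (N.visibleRIS P ω)

def distU (ω : Ω) : ℝ≥0∞ := nearest (N.hapU ω)

/-- Amplitudes of the fading coefficients, and the three horizontal distances. -/
def source : Source p.L → Ω → ℝ≥0∞
  | .q l => fun ω => ‖N.q l ω‖ₑ
  | .g l => fun ω => ‖N.g l ω‖ₑ
  | .u => fun ω => ‖N.u ω‖ₑ
  | .distQ => N.distQ
  | .distG => N.distG P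
  | .distU => N.distU

structure IsModel : Prop where
  hapQ_poisson : IsPoissonProcess N.hapQ p.hapIntensity P
  hapU_poisson : IsPoissonProcess N.hapU p.hapIntensity P
  ris_poisson : IsPoissonProcess N.ris p.risIntensity P
  buildings_poisson : IsPoissonProcess N.buildings p.buildingIntensity P
  q_measurable : ∀ l, Measurable (N.q l)
  g_measurable : ∀ l, Measurable (N.g l)
  u_measurable : Measurable N.u
  q_law : ∀ l, P.map (fun ω => ‖N.q l ω‖) = kappaMuMeasure p.κq p.μq
  g_law : ∀ l, P.map (fun ω => ‖N.g l ω‖) = kappaMuMeasure p.κg p.μg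
  u_law : P.map (fun ω => ‖N.u ω‖) = kappaMuMeasure p.κu p.μu
  indep : iIndepFun (N.source P) P

/-- Response `exp(jθ_l)` of the `l`-th reflecting element, with the optimized phase shift
`θ_l = ∠u - (∠q_l + ∠g_l)`. -/
def ζ (l : Fin p.L) (ω : Ω) : ℂ :=
  Complex.exp (Complex.I *
    (((N.u ω).arg - ((N.q l ω).arg + (N.g l ω).arg) : ℝ) : ℂ))

/-- Combined channel response. -/
def A (ω : Ω) : ℂ :=
  (∑ l, N.q l ω * N.g l ω * N.ζ l ω) *
      (pathGain p.expQ (diagonal (N.distQ ω) (p.heightHAP - p.heightRIS)) : ℂ) *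
      (pathGain p.expG (diagonal (N.distG P ω) p.heightRIS) : ℂ) +
    N.u ω * (pathGain p.expU (diagonal (N.distU ω) p.heightHAP) : ℂ)

/-- The random variable `|A|`. -/
def absA (ω : Ω) : ℝ := ‖N.A P ω‖

/-- End-to-end signal-to-noise ratio. -/
def snr (ω : Ω) : ℝ := p.ρ₀ * N.absA P ω ^ 2

end Network

/-! ### Laguerre series of a density -/

/-- `k`-th coefficient of the Laguerre series, with parameters `α, β`, of the law of `X`. -/
def laguerreCoeff {Ω : Type*} [MeasurableSpace Ω] (P : Measure Ω) (X : Ω → ℝ) (α β : ℝ)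
    (k : ℕ) : ℝ :=
  (k.factorial : ℝ) * Real.Gamma α / Real.Gamma ((k : ℝ) + α) *
    ∫ ω, laguerre k (α - 1) (X ω / β) ∂P

/-- `k`-th term of the Laguerre series
`f_X(x) ~ x^(α-1) e^(-x/β) / (β^α Γ(α)) · ∑ₖ cₖ L_k^(α-1)(x/β)`. -/
def laguerreTerm {Ω : Type*} [MeasurableSpace Ω] (P : Measure Ω) (X : Ω → ℝ) (α β : ℝ)
    (k : ℕ) (x : ℝ) : ℝ :=
  x ^ (α - 1) / (β ^ α * Real.Gamma α) * Real.exp (-(x / β)) *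
    (laguerreCoeff P X α β k * laguerre k (α - 1) (x / β))

/-- The approximating density of the signal-to-noise ratio. -/
def snrApprox (ρ₀ α β x : ℝ) : ℝ :=
  1 / (2 * β ^ α * Real.Gamma α) * ρ₀ ^ (-(α / 2)) * x ^ ((α - 2) / 2) *
    Real.exp (-√(x / (β ^ 2 * ρ₀)))

end

end HapRis

namespace HapRis

/-! ### Moments of the `κ`-`μ` distribution -/

/-! The phase shifts give every reflected path the phase of `u`. Hence `A` is a unit complex number
times a nonnegative real, and `|A|` is (sum of products of fading amplitudes) × (two path gains) +
`‖u‖` × (one path gain), a polynomial in independent real variables (`Network.absA_eq`).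
Independence reduces the mean and the variance to the first two moments of each variable.

Fading: expanding the Bessel function makes the `κ`-`μ` law a mixture of Nakagami laws, and the
moments follow termwise (`lintegral_rpow_kappaMuMeasure`).

Distances: each distance is below `r` exactly when a Poisson process meets a test set, so its law is
given by void probabilities (`HasHazard`). For HAPs the test set is a disc. For RISs it is the
region below the graph of the visibility probability, in the space of marked points. That
probability is the void probability of the set of blocking buildings, whose intensity is `λ_B` times
the mean area swept by a rectangle along the segment (`volume_sweep`, `buildingIntensity_blocking`).
With positive probability no RIS is visible; the gain is then `0`, so only finite distances enter
the moments.

Density: given the other variables, `|A|` is affine in `‖u‖` with almost surely nonzero slope, and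
`‖u‖` has a density (`map_add_mul_absolutelyContinuous`). A law with a density has no atoms, so mean
and variance are positive. The SNR density is a change of variables (`map_mul_sq_withDensity`).

Approximation: `c₁` and `c₂` involve only the first two moments of `|A|`, and those agree with the
Gamma law, so both vanish. -/

lemma lintegral_rpow_mul_exp_neg_mul_sq {c a : ℝ} (hc : -1 < c) (ha : 0 < a) :
    ∫⁻ r in Ioi (0 : ℝ), ENNReal.ofReal (r ^ c * Real.exp (-(a * r ^ 2))) =
      ENNReal.ofReal (a ^ (-((c + 1) / 2)) * (1 / 2) * Real.Gamma ((c + 1) / 2)) := by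
  have h := integral_rpow_mul_exp_neg_mul_rpow (p := 2) (q := c) (b := a) (by norm_num) hc ha
  have hi := integrableOn_rpow_mul_exp_neg_mul_rpow (p := 2) (s := c) (b := a) hc (by norm_num) ha
  simp only [Real.rpow_two, neg_mul] at h hi
  rw [← neg_div, ← h, ofReal_integral_eq_lintegral_ofReal hi]
  filter_upwards [ae_restrict_mem measurableSet_Ioi] with r hr
  have : (0 : ℝ) < r := hr
  positivity

/-- Coefficients of the power series of the `κ`-`μ` density. -/
noncomputable def kappaMuCoeff (κ μ : ℝ) (n : ℕ) : ℝ :=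
  2 * Real.exp (-(κ * μ)) * ((1 + κ) * μ) ^ μ * (κ * μ) ^ n * ((1 + κ) * μ) ^ n /
    (n.factorial * Real.Gamma (n + μ))

lemma kappaMuCoeff_nonneg {κ μ : ℝ} (hκ : 0 ≤ κ) (hμ : 0 < μ) (n : ℕ) :
    0 ≤ kappaMuCoeff κ μ n := by
  have := Real.Gamma_pos_of_pos (show 0 < (n : ℝ) + μ by positivity)
  unfold kappaMuCoeff
  positivity

/-- Consecutive terms have ratio `(z/2)² / ((n+1)(n+ν+1))`, which tends to `0`. Summability allows
`ENNReal.ofReal` to pass through the series. -/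
lemma summable_besselI {ν z : ℝ} (hν : -1 < ν) (hz : 0 < z) :
    Summable fun n : ℕ => (z / 2) ^ (2 * (n : ℝ) + ν) /
      ((n.factorial : ℝ) * Real.Gamma ((n : ℝ) + ν + 1)) := by
  have hG : ∀ n : ℕ, 0 < Real.Gamma ((n : ℝ) + ν + 1) := fun n =>
    Real.Gamma_pos_of_pos (by have : (0 : ℝ) ≤ n := n.cast_nonneg; linarith)
  refine summable_of_ratio_test_tendsto_lt_one (l := 0) zero_lt_one
    (Filter.Eventually.of_forall fun n => ?_) ?_
  · have := hG n
    positivity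
  · have key : ∀ n : ℕ, ‖(z / 2) ^ (2 * ((n + 1 : ℕ) : ℝ) + ν) /
        (((n + 1).factorial : ℝ) * Real.Gamma (((n + 1 : ℕ) : ℝ) + ν + 1))‖ /
        ‖(z / 2) ^ (2 * (n : ℝ) + ν) / ((n.factorial : ℝ) * Real.Gamma ((n : ℝ) + ν + 1))‖ =
        (z / 2) ^ 2 * (((n : ℝ) + 1)⁻¹ * ((n : ℝ) + (ν + 1))⁻¹) := by
      intro n
      have h1 := hG n
      have h2 := hG (n + 1)
      have h0 : 0 < (n : ℝ) + ν + 1 := by have : (0 : ℝ) ≤ n := n.cast_nonneg; linarith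
      have h3 : (z / 2) ^ (2 * ((n + 1 : ℕ) : ℝ) + ν) = (z / 2) ^ (2 * (n : ℝ) + ν) * (z / 2) ^ 2 := by
        rw [← Real.rpow_natCast (z / 2) 2, ← Real.rpow_add (by positivity)]
        congr 1; push_cast; ring
      have h4 : Real.Gamma (((n + 1 : ℕ) : ℝ) + ν + 1) =
          ((n : ℝ) + ν + 1) * Real.Gamma ((n : ℝ) + ν + 1) := by
        rw [← Real.Gamma_add_one h0.ne']; congr 1; push_cast; ring
      rw [Real.norm_of_nonneg (by positivity), Real.norm_of_nonneg (by positivity), h3, h4,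
        Nat.factorial_succ]
      have h5 : (z / 2) ^ (2 * (n : ℝ) + ν) ≠ 0 := by positivity
      rw [← add_assoc]
      push_cast
      field_simp
    simp_rw [key]
    have t : Filter.Tendsto (fun n : ℕ => (n : ℝ)) Filter.atTop Filter.atTop :=
      tendsto_natCast_atTop_atTop
    have t1 := (Filter.tendsto_atTop_add_const_right _ (1 : ℝ) t).inv_tendsto_atTop
    have t2 := (Filter.tendsto_atTop_add_const_right _ (ν + 1) t).inv_tendsto_atTop
    simpa using (t1.mul t2).const_mul ((z / 2) ^ 2)

lemma ofReal_kappaMuPDF {κ μ r : ℝ} (hκ : 0 ≤ κ) (hμ : 0 < μ) (hr : 0 < r) :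
    ENNReal.ofReal (kappaMuPDF κ μ r) = ∑' n : ℕ, ENNReal.ofReal (kappaMuCoeff κ μ n *
      (r ^ (2 * n + 2 * μ - 1) * Real.exp (-((1 + κ) * μ * r ^ 2)))) := by
  have hC := kappaMuCoeff_nonneg hκ hμ
  rcases hκ.eq_or_lt with rfl | hκ'
  -- For `κ = 0` the factor `(κ μ)^n` removes every term but the first, which is the Nakagami
  -- density.
  · rw [tsum_eq_single 0]
    · simp only [kappaMuPDF, kappaMuCoeff]
      simp
      congr 1
      ring
    · intro n hn
      simp [kappaMuCoeff, hn]
  · set z := 2 * μ * √(κ * (1 + κ)) * r with hzdef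
    have hz : 0 < z := by positivity
    set c := 2 * μ * (1 + κ) ^ ((μ + 1) / 2) / (κ ^ ((μ - 1) / 2) * Real.exp (μ * κ)) * r ^ μ *
      Real.exp (-(μ * (1 + κ) * r ^ 2)) with hc
    have hs := (summable_besselI (ν := μ - 1) (by linarith) hz).mul_left c
    have hterm : ∀ n : ℕ, c * ((z / 2) ^ (2 * (n : ℝ) + (μ - 1)) /
        ((n.factorial : ℝ) * Real.Gamma ((n : ℝ) + (μ - 1) + 1))) = kappaMuCoeff κ μ n *
        (r ^ (2 * n + 2 * μ - 1) * Real.exp (-((1 + κ) * μ * r ^ 2))) := by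
      intro n
      have e1 : (n : ℝ) + (μ - 1) + 1 = n + μ := by ring
      have e2 : z / 2 = μ * (κ ^ (1 / 2 : ℝ) * (1 + κ) ^ (1 / 2 : ℝ)) * r := by
        rw [hzdef, Real.sqrt_eq_rpow, Real.mul_rpow hκ (by positivity)]; ring
      have e3 : (z / 2) ^ (2 * (n : ℝ) + (μ - 1)) = μ ^ (2 * (n : ℝ) + (μ - 1)) *
          (κ ^ ((n : ℝ) + (μ - 1) / 2) * (1 + κ) ^ ((n : ℝ) + (μ - 1) / 2)) *
          r ^ (2 * (n : ℝ) + (μ - 1)) := by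
        rw [e2, Real.mul_rpow (by positivity) hr.le, Real.mul_rpow hμ.le (by positivity),
          Real.mul_rpow (by positivity) (by positivity), ← Real.rpow_mul hκ,
          ← Real.rpow_mul (by positivity)]
        congr <;> ring
      have e4 : μ * μ ^ (2 * (n : ℝ) + (μ - 1)) = μ ^ μ * μ ^ n * μ ^ n := by
        rw [← Real.rpow_natCast, ← Real.rpow_add hμ, ← Real.rpow_add hμ]
        nth_rewrite 1 [← Real.rpow_one μ]
        rw [← Real.rpow_add hμ]; congr 1; ring
      have e5 : κ ^ ((n : ℝ) + (μ - 1) / 2) = κ ^ n * κ ^ ((μ - 1) / 2) := by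
        rw [Real.rpow_add hκ', Real.rpow_natCast]
      have e6 : (1 + κ) ^ ((μ + 1) / 2) * (1 + κ) ^ ((n : ℝ) + (μ - 1) / 2) =
          (1 + κ) ^ μ * (1 + κ) ^ n := by
        rw [← Real.rpow_natCast, ← Real.rpow_add (by positivity), ← Real.rpow_add (by positivity)]
        congr 1; ring
      have e7 : r ^ μ * r ^ (2 * (n : ℝ) + (μ - 1)) = r ^ (2 * n + 2 * μ - 1) := by
        rw [← Real.rpow_add hr]; congr 1; ring
      have hk : κ ^ ((μ - 1) / 2) ≠ 0 := by positivity
      have hG : Real.Gamma (n + μ) ≠ 0 := (Real.Gamma_pos_of_pos (by positivity)).ne'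
      rw [e1, e3, hc, kappaMuCoeff, Real.mul_rpow (by positivity) hμ.le, mul_pow, mul_pow, e5,
        Real.exp_neg (κ * μ), mul_comm κ μ, mul_comm (1 + κ) μ]
      calc _ = 2 * (μ * μ ^ (2 * (n : ℝ) + (μ - 1))) *
            ((1 + κ) ^ ((μ + 1) / 2) * (1 + κ) ^ ((n : ℝ) + (μ - 1) / 2)) * κ ^ n *
            (r ^ μ * r ^ (2 * (n : ℝ) + (μ - 1))) * Real.exp (-(μ * (1 + κ) * r ^ 2)) *
            (Real.exp (μ * κ))⁻¹ / (n.factorial * Real.Gamma (n + μ)) := by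
            -- The real powers become atoms, so that `field_simp` does not rewrite their exponents.
            generalize (1 + κ) ^ ((n : ℝ) + (μ - 1) / 2) = x1
            generalize μ ^ (2 * (n : ℝ) + (μ - 1)) = x2
            generalize r ^ (2 * (n : ℝ) + (μ - 1)) = x3
            generalize κ ^ ((μ - 1) / 2) = x4 at hk
            field_simp
        _ = _ := by rw [e4, e6, e7]; ring
    rw [kappaMuPDF, if_neg hκ'.ne', besselI, ← tsum_mul_left, ENNReal.ofReal_tsum_of_nonneg _ hs]
    · simp_rw [hterm]
    · intro n
      rw [hterm]
      exact mul_nonneg (hC n) (by positivity)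

/-- The `κ`-`μ` law as a mixture of Nakagami-type densities. -/
lemma kappaMuMeasure_eq {κ μ : ℝ} (hκ : 0 ≤ κ) (hμ : 0 < μ) :
    kappaMuMeasure κ μ = (volume.restrict (Ioi 0)).withDensity fun r : ℝ =>
      ∑' n : ℕ, ENNReal.ofReal (kappaMuCoeff κ μ n *
        (r ^ (2 * n + 2 * μ - 1) * Real.exp (-((1 + κ) * μ * r ^ 2)))) := by
  refine withDensity_congr_ae ?_
  filter_upwards [ae_restrict_mem measurableSet_Ioi] with r hr
  exact ofReal_kappaMuPDF hκ hμ hr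

/-- By Tonelli the mixture is integrated term by term, each term being a Gamma integral. Working in
`ℝ≥0∞` avoids any prior question of convergence. -/
lemma lintegral_rpow_kappaMuMeasure {κ μ s : ℝ} (hκ : 0 ≤ κ) (hμ : 0 < μ) (hs : 0 ≤ s) :
    ∫⁻ r, ENNReal.ofReal (r ^ s) ∂kappaMuMeasure κ μ = ∑' n : ℕ, ENNReal.ofReal
      (Real.exp (-(κ * μ)) * ((1 + κ) * μ) ^ (-(s / 2)) *
        ((κ * μ) ^ n / n.factorial * (Real.Gamma (n + μ + s / 2) / Real.Gamma (n + μ)))) := by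
  have ha : 0 < (1 + κ) * μ := by positivity
  rw [kappaMuMeasure_eq hκ hμ, lintegral_withDensity_eq_lintegral_mul _ (by fun_prop) (by fun_prop)]
  simp only [Pi.mul_apply]
  simp_rw [← ENNReal.tsum_mul_right]
  rw [lintegral_tsum (fun n => by fun_prop)]
  refine tsum_congr fun n => ?_
  have hC := kappaMuCoeff_nonneg hκ hμ n
  have hG : Real.Gamma (n + μ) ≠ 0 := (Real.Gamma_pos_of_pos (by positivity)).ne'
  have hn : (0 : ℝ) ≤ n := n.cast_nonneg
  have e : ∀ r ∈ Ioi (0 : ℝ), ENNReal.ofReal (kappaMuCoeff κ μ n *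
      (r ^ (2 * n + 2 * μ - 1) * Real.exp (-((1 + κ) * μ * r ^ 2)))) * ENNReal.ofReal (r ^ s) =
      ENNReal.ofReal (kappaMuCoeff κ μ n) * ENNReal.ofReal
        (r ^ (2 * n + 2 * μ - 1 + s) * Real.exp (-((1 + κ) * μ * r ^ 2))) := by
    intro r (hr : 0 < r)
    rw [← ENNReal.ofReal_mul (by positivity), ← ENNReal.ofReal_mul hC, Real.rpow_add hr]
    congr 1; ring
  rw [setLIntegral_congr_fun measurableSet_Ioi e, lintegral_const_mul _ (by fun_prop),
    lintegral_rpow_mul_exp_neg_mul_sq (by linarith) ha, ← ENNReal.ofReal_mul hC]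
  congr 1
  have e1 : (2 * (n : ℝ) + 2 * μ - 1 + s + 1) / 2 = n + μ + s / 2 := by ring
  have e2 : ((1 + κ) * μ) ^ (-((n : ℝ) + μ + s / 2)) * (((1 + κ) * μ) ^ μ * ((1 + κ) * μ) ^ n) =
      ((1 + κ) * μ) ^ (-(s / 2)) := by
    rw [← Real.rpow_natCast, ← Real.rpow_add ha, ← Real.rpow_add ha]
    congr 1; ring
  rw [e1, ← e2, kappaMuCoeff]
  ring

lemma integral_rpow_kappaMuMeasure {κ μ s : ℝ} (hκ : 0 ≤ κ) (hμ : 0 < μ) (hs : 0 ≤ s) :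
    ∫ r, r ^ s ∂kappaMuMeasure κ μ = ∑' n : ℕ,
      (Real.exp (-(κ * μ)) * ((1 + κ) * μ) ^ (-(s / 2)) *
        ((κ * μ) ^ n / n.factorial * (Real.Gamma (n + μ + s / 2) / Real.Gamma (n + μ)))) := by
  -- No summability is needed here: in the divergent case both sides are `0` by convention.
  rw [integral_eq_lintegral_of_nonneg_ae _ (by fun_prop), lintegral_rpow_kappaMuMeasure hκ hμ hs,
    ENNReal.tsum_toReal_eq (fun _ => ENNReal.ofReal_ne_top)]
  · refine tsum_congr fun n => ENNReal.toReal_ofReal ?_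
    have h1 := Real.Gamma_pos_of_pos (show 0 < (n : ℝ) + μ by positivity)
    have h2 := Real.Gamma_pos_of_pos (show 0 < (n : ℝ) + μ + s / 2 by positivity)
    positivity
  · refine (withDensity_absolutelyContinuous _ _).ae_le ?_
    filter_upwards [ae_restrict_mem measurableSet_Ioi] with r hr
    exact Real.rpow_nonneg (le_of_lt hr) _

lemma ascPochhammer_eval_eq_Gamma_div {a : ℝ} (ha : 0 < a) (n : ℕ) :
    (ascPochhammer ℝ n).eval a = Real.Gamma (n + a) / Real.Gamma a := by
  have h := (Real.Gamma_pos_of_pos ha).ne'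
  induction n with
  | zero => simp [h]
  | succ k ih =>
    rw [ascPochhammer_succ_eval, ih, show ((k + 1 : ℕ) : ℝ) + a = (k + a) + 1 by push_cast; ring,
      Real.Gamma_add_one (by positivity)]
    ring

/-- The mean of the `κ`-`μ` law. -/
lemma integral_kappaMuMeasure {κ μ : ℝ} (hκ : 0 ≤ κ) (hμ : 0 < μ) :
    ∫ r, r ∂kappaMuMeasure κ μ = kappaMuMean κ μ := by
  have h := integral_rpow_kappaMuMeasure hκ hμ zero_le_one
  simp only [Real.rpow_one] at h
  rw [h, kappaMuMean, kummer, ← tsum_mul_left]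
  refine tsum_congr fun n => ?_
  have h0 := (Real.Gamma_pos_of_pos hμ).ne'
  have h1 := (Real.Gamma_pos_of_pos (show 0 < μ + 1 / 2 by positivity)).ne'
  have h2 := (Real.Gamma_pos_of_pos (show 0 < (n : ℝ) + μ by positivity)).ne'
  rw [ascPochhammer_eval_eq_Gamma_div hμ, ascPochhammer_eval_eq_Gamma_div (by positivity),
    Real.rpow_neg (by positivity), add_assoc]
  field_simp

/-- The second moment of the `κ`-`μ` law. -/
lemma integral_sq_kappaMuMeasure {κ μ : ℝ} (hκ : 0 ≤ κ) (hμ : 0 < μ) :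
    ∫ r, r ^ 2 ∂kappaMuMeasure κ μ = 1 := by
  have h := integral_rpow_kappaMuMeasure hκ hμ zero_le_two
  simp only [Real.rpow_two] at h
  rw [h, tsum_mul_left]
  have hexp : HasSum (fun n : ℕ => (κ * μ) ^ n / n.factorial) (Real.exp (κ * μ)) := by
    rw [Real.exp_eq_exp_ℝ]; exact NormedSpace.expSeries_div_hasSum_exp (κ * μ)
  -- The first moment of the Poisson weights, by an index shift; the term `n = 0` vanishes.
  have h1 : HasSum (fun n : ℕ => (κ * μ) ^ n / n.factorial * (n : ℝ))
      (κ * μ * Real.exp (κ * μ)) := by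
    rw [← hasSum_nat_add_iff' 1]
    simp only [Finset.range_one, Finset.sum_singleton, Nat.cast_zero, mul_zero, sub_zero]
    refine (hexp.mul_left (κ * μ)).congr_fun ?_
    intro n
    rw [Nat.factorial_succ]
    push_cast
    field_simp
    ring
  have h2 := h1.add (hexp.mul_right μ)
  -- For `s = 2` the Gamma quotient is just `n + μ`, so the sum is `(κ μ + μ) e^(κ μ)`, cancelled by
  -- the prefactor.
  have : ∀ n : ℕ, (κ * μ) ^ n / n.factorial * (Real.Gamma (n + μ + 2 / 2) / Real.Gamma (n + μ)) =
      (κ * μ) ^ n / n.factorial * (n : ℝ) + (κ * μ) ^ n / n.factorial * μ := by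
    intro n
    have h2 := (Real.Gamma_pos_of_pos (show 0 < (n : ℝ) + μ by positivity)).ne'
    rw [div_self two_ne_zero, Real.Gamma_add_one (by positivity)]
    field_simp
  simp_rw [this]
  rw [h2.tsum_eq, div_self two_ne_zero, Real.rpow_neg_one, Real.exp_neg]
  field_simp
  ring

/-- The Bochner integral of a nonintegrable function is `0`, whereas this one equals `1`. -/
lemma integrable_sq_kappaMuMeasure {κ μ : ℝ} (hκ : 0 ≤ κ) (hμ : 0 < μ) :
    Integrable (fun r => r ^ 2) (kappaMuMeasure κ μ) := by
  by_contra h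
  have := integral_sq_kappaMuMeasure hκ hμ
  rw [integral_undef h] at this
  exact zero_ne_one this

/-! ### Moments of the Gamma distribution -/

/-- `gammaPDF` is supported on the closed half-line; dropping the null point `0` gives the form
needed for the change of variables. -/
lemma gammaMeasure_eq_restrict (a r : ℝ) : gammaMeasure a r =
    (volume.restrict (Ioi 0)).withDensity fun x =>
      ENNReal.ofReal (r ^ a / Real.Gamma a * x ^ (a - 1) * Real.exp (-(r * x))) := by
  rw [gammaMeasure, ← withDensity_indicator measurableSet_Ioi]
  refine withDensity_congr_ae ?_
  have h0 : ∀ᵐ x : ℝ, x ≠ 0 := by simp [ae_iff]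
  filter_upwards [h0] with x hx
  rcases hx.lt_or_gt with h | h
  · rw [gammaPDF_of_neg h, indicator_of_notMem (by simpa using h.le)]
  · rw [gammaPDF_of_nonneg h.le, indicator_of_mem (show x ∈ Ioi 0 from h)]

lemma integral_pow_gammaMeasure {a r : ℝ} (ha : 0 < a) (hr : 0 < r) (k : ℕ) :
    ∫ x, x ^ k ∂gammaMeasure a r = Real.Gamma (k + a) / Real.Gamma a / r ^ k := by
  rw [gammaMeasure_eq_restrict, integral_withDensity_eq_integral_toReal_smul (by fun_prop)
    (ae_of_all _ fun _ => ENNReal.ofReal_lt_top)]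
  have e : ∀ x ∈ Ioi (0 : ℝ), (ENNReal.ofReal (r ^ a / Real.Gamma a * x ^ (a - 1) *
      Real.exp (-(r * x)))).toReal • x ^ k =
      r ^ a / Real.Gamma a * (x ^ (k + a - 1) * Real.exp (-(r * x))) := by
    intro x (hx : 0 < x)
    rw [ENNReal.toReal_ofReal (by positivity), smul_eq_mul, add_sub_assoc, Real.rpow_add hx,
      Real.rpow_natCast]
    ring
  have hG := (Real.Gamma_pos_of_pos ha).ne'
  rw [setIntegral_congr_fun measurableSet_Ioi e, integral_const_mul,
    Real.integral_rpow_mul_exp_neg_mul_Ioi (by positivity) hr, Real.div_rpow zero_le_one hr.le,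
    Real.one_rpow, Real.rpow_add hr, Real.rpow_natCast]
  field_simp

lemma integral_gammaMeasure {a r : ℝ} (ha : 0 < a) (hr : 0 < r) :
    ∫ x, x ∂gammaMeasure a r = a / r := by
  have h := integral_pow_gammaMeasure ha hr 1
  have hG := (Real.Gamma_pos_of_pos ha).ne'
  rw [Nat.cast_one, add_comm, Real.Gamma_add_one ha.ne'] at h
  simpa [hG] using h

lemma integral_sq_gammaMeasure {a r : ℝ} (ha : 0 < a) (hr : 0 < r) :
    ∫ x, x ^ 2 ∂gammaMeasure a r = (a + 1) * a / r ^ 2 := by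
  have hG := (Real.Gamma_pos_of_pos ha).ne'
  rw [integral_pow_gammaMeasure ha hr 2, show ((2 : ℕ) : ℝ) + a = a + 1 + 1 by push_cast; ring,
    Real.Gamma_add_one (by positivity), Real.Gamma_add_one ha.ne']
  field_simp

lemma variance_gammaMeasure {a r : ℝ} (ha : 0 < a) (hr : 0 < r) :
    variance id (gammaMeasure a r) = a / r ^ 2 := by
  have := isProbabilityMeasure_gammaMeasure ha hr
  have h2 := integral_sq_gammaMeasure ha hr
  have hi : Integrable (fun x => x ^ 2) (gammaMeasure a r) := by
    by_contra h
    rw [integral_undef h] at h2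
    have : 0 < (a + 1) * a / r ^ 2 := by positivity
    exact this.ne h2
  have hm : MemLp id 2 (gammaMeasure a r) :=
    (memLp_two_iff_integrable_sq measurable_id.aestronglyMeasurable).2 hi
  rw [variance_eq_sub hm]
  simp only [Pi.pow_apply, id]
  rw [h2, integral_gammaMeasure ha hr]
  field_simp
  ring

/-! ### The law of a scaled square -/

/-- Change of variables along `x ↦ √(x / c)`, the inverse of `y ↦ c y²` on the half-line. It serves
both for `|A|` and for the Gamma law. -/
lemma map_mul_sq_withDensity {c : ℝ} (hc : 0 < c) (f : ℝ → ℝ≥0∞) :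
    ((volume.restrict (Ioi 0)).withDensity f).map (fun y => c * y ^ 2) =
      (volume.restrict (Ioi 0)).withDensity fun x =>
        ENNReal.ofReal (1 / (2 * √(c * x))) * f (√(x / c)) := by
  ext s hs
  have hm : Measurable fun y : ℝ => c * y ^ 2 := by fun_prop
  have himg : (fun x => √(x / c)) '' (Ioi 0) = Ioi (0 : ℝ) := by
    ext y
    constructor
    · rintro ⟨x, hx, rfl⟩
      exact Real.sqrt_pos.2 (div_pos hx hc)
    · intro (hy : 0 < y)
      refine ⟨c * y ^ 2, mul_pos hc (by positivity), ?_⟩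
      simp only
      rw [mul_div_cancel_left₀ _ hc.ne', Real.sqrt_sq hy.le]
  have hderiv : ∀ x ∈ Ioi (0 : ℝ),
      HasDerivWithinAt (fun x => √(x / c)) (1 / (2 * √(c * x))) (Ioi 0) x := by
    intro x (hx : 0 < x)
    have h1 := ((hasDerivAt_id x).div_const c).sqrt (div_pos hx hc).ne'
    refine (h1.congr_deriv ?_).hasDerivWithinAt
    rw [id, Real.sqrt_div hx.le, Real.sqrt_mul hc.le]
    have h2 := Real.sqrt_pos.2 hx
    have h3 := Real.sqrt_pos.2 hc
    have h4 := Real.sq_sqrt hc.le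
    field_simp
    exact h4
  have hinj : InjOn (fun x => √(x / c)) (Ioi (0 : ℝ)) := by
    intro x (hx : 0 < x) y (hy : 0 < y) h
    have := (Real.sqrt_inj (div_pos hx hc).le (div_pos hy hc).le).1 h
    field_simp at this
    exact this
  rw [Measure.map_apply hm hs, withDensity_apply _ (hm hs), withDensity_apply _ hs,
    ← lintegral_indicator (hm hs), ← lintegral_indicator hs]
  -- The test set is absorbed into the integrand as an indicator, so the substitution is made on the
  -- whole half-line.
  have key := lintegral_image_eq_lintegral_abs_deriv_mul measurableSet_Ioi hderiv hinj
    (((fun y => c * y ^ 2) ⁻¹' s).indicator f)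
  rw [himg] at key
  rw [key]
  refine setLIntegral_congr_fun measurableSet_Ioi fun x (hx : 0 < x) => ?_
  have e : c * √(x / c) ^ 2 = x := by
    rw [Real.sq_sqrt (div_pos hx hc).le]; field_simp
  rw [abs_of_nonneg (by positivity)]
  by_cases hxs : x ∈ s
  · rw [indicator_of_mem (show √(x / c) ∈ _ by simpa [e] using hxs), indicator_of_mem hxs]
  · rw [indicator_of_notMem (by simpa [e] using hxs), indicator_of_notMem hxs, mul_zero]

/-! ### Void probabilities and nearest points of Poisson processes -/

section Poisson

variable {Ω X : Type*} [MeasurableSpace Ω] [MeasurableSpace X] {Φ : Ω → Set X} {ν : Measure X}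
  {P : Measure Ω}

lemma IsPoissonProcess.measurableSet_nonempty (h : IsPoissonProcess Φ ν P) {B : Set X}
    (hB : MeasurableSet B) : MeasurableSet {ω | (Φ ω ∩ B).Nonempty} := by
  have : {ω | (Φ ω ∩ B).Nonempty} = (fun ω => (Φ ω ∩ B).encard) ⁻¹' {0}ᶜ := by
    ext ω
    simp [nonempty_iff_ne_empty]
  rw [this]
  exact h.measurable_count B hB (measurableSet_singleton 0).compl

lemma IsPoissonProcess.measure_void (h : IsPoissonProcess Φ ν P) {B : Set X}
    (hB : MeasurableSet B) (hν : ν B ≠ ∞) :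
    P {ω | Φ ω ∩ B = ∅} = ENNReal.ofReal (Real.exp (-(ν B).toReal)) := by
  have h1 : {ω | Φ ω ∩ B = ∅} = (fun ω => (Φ ω ∩ B).encard) ⁻¹' {0} := by
    ext ω; simp
  have h2 : (fun n : ℕ => (n : ℕ∞)) ⁻¹' {0} = {0} := by
    ext n; simp
  rw [h1, ← Measure.map_apply (h.measurable_count B hB) (measurableSet_singleton 0),
    h.count_law B hB hν, Measure.map_apply measurable_from_top (measurableSet_singleton 0), h2,
    poissonMeasure_singleton]
  simp [ENNReal.coe_toNNReal_eq_toReal]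

lemma IsPoissonProcess.measure_nonempty [IsProbabilityMeasure P] (h : IsPoissonProcess Φ ν P)
    {B : Set X} (hB : MeasurableSet B) (hν : ν B ≠ ∞) :
    P {ω | (Φ ω ∩ B).Nonempty} = ENNReal.ofReal (1 - Real.exp (-(ν B).toReal)) := by
  have h1 : {ω | Φ ω ∩ B = ∅} = {ω | (Φ ω ∩ B).Nonempty}ᶜ := by
    ext ω; simp [not_nonempty_iff_eq_empty]
  have h2 := h.measure_void hB hν
  rw [h1, prob_compl_eq_one_sub (h.measurableSet_nonempty hB)] at h2
  rw [ENNReal.ofReal_sub _ (Real.exp_pos _).le, ← h2, ENNReal.ofReal_one,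
    ENNReal.sub_sub_cancel ENNReal.one_ne_top prob_le_one]

end Poisson

lemma nearest_lt_iff {S : Set Plane} {r : ℝ≥0∞} : nearest S < r ↔ ∃ x ∈ S, ‖x‖ₑ < r := by
  simp [nearest, iInf_lt_iff]

/-- The rays `Iio r` generate the σ-algebra of `ℝ≥0∞`, and their preimages are hitting events of the
process. -/
lemma measurable_of_nearest {Ω X : Type*} [MeasurableSpace Ω] [MeasurableSpace X]
    {Φ : Ω → Set X} {ν : Measure X} {P : Measure Ω} (h : IsPoissonProcess Φ ν P)
    {D : Ω → ℝ≥0∞} {B : ℝ≥0∞ → Set X} (hB : ∀ r, MeasurableSet (B r))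
    (hD : ∀ r ω, D ω < r ↔ (Φ ω ∩ B r).Nonempty) : Measurable D := by
  refine measurable_of_Iio fun r => ?_
  have : D ⁻¹' Iio r = {ω | (Φ ω ∩ B r).Nonempty} := by
    ext ω; exact hD r ω
  rw [this]
  exact h.measurableSet_nonempty (hB r)

/-! ### The law of a distance with given hazard rate -/

/-- `D` is a random distance, possibly infinite, with cumulative hazard `Λ` and hazard rate
`lam`. -/
structure HasHazard {Ω : Type*} [MeasurableSpace Ω] (D : Ω → ℝ≥0∞) (P : Measure Ω)
    (Λ lam : ℝ → ℝ) : Prop where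
  measurable : Measurable D
  measure_lt : ∀ r, 0 ≤ r → P {ω | D ω < ENNReal.ofReal r} = ENNReal.ofReal (1 - Real.exp (-Λ r))
  zero : Λ 0 = 0
  deriv : ∀ r, HasDerivAt Λ (lam r) r
  continuous : Continuous lam
  nonneg : ∀ r, 0 ≤ r → 0 ≤ lam r

section Hazard

variable {Ω : Type*} [MeasurableSpace Ω] {D : Ω → ℝ≥0∞} {P : Measure Ω} {Λ lam : ℝ → ℝ}

lemma HasHazard.continuous_cumulative (h : HasHazard D P Λ lam) : Continuous Λ :=
  continuous_iff_continuousAt.2 fun r => (h.deriv r).continuousAt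

/-- The integrand is the derivative of `-exp(-Λ)`, and `Λ 0 = 0`. -/
lemma HasHazard.lintegral_density (h : HasHazard D P Λ lam) {r : ℝ} (hr : 0 ≤ r) :
    ∫⁻ w in Ioo 0 r, ENNReal.ofReal (lam w * Real.exp (-Λ w)) =
      ENNReal.ofReal (1 - Real.exp (-Λ r)) := by
  have hc := h.continuous_cumulative
  have hl := h.continuous
  have hcont : Continuous fun w => lam w * Real.exp (-Λ w) := by fun_prop
  have hF : ∀ w, HasDerivAt (fun w => -Real.exp (-Λ w)) (lam w * Real.exp (-Λ w)) w := by
    intro w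
    exact ((h.deriv w).neg.exp.neg).congr_deriv (by simp; ring)
  have hI := intervalIntegral.integral_eq_sub_of_hasDerivAt (a := 0) (b := r) (fun w _ => hF w)
    (hcont.intervalIntegrable _ _)
  rw [intervalIntegral.integral_of_le hr, h.zero, neg_zero, Real.exp_zero] at hI
  rw [← restrict_Ioo_eq_restrict_Ioc] at hI
  rw [show 1 - Real.exp (-Λ r) = -Real.exp (-Λ r) - -1 by ring, ← hI,
    ofReal_integral_eq_lintegral_ofReal]
  · exact (hcont.integrableOn_Icc (a := 0) (b := r)).mono_set Ioo_subset_Icc_self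
  · filter_upwards [ae_restrict_mem measurableSet_Ioo] with w hw
    exact mul_nonneg (h.nonneg w hw.1.le) (Real.exp_pos _).le

/-- Both measures agree on the generating π-system of open left rays. The restriction to `D < ∞` is
essential, because `toReal` sends `∞` to `0`; the mass may be less than `1`. -/
lemma HasHazard.map_toReal [IsProbabilityMeasure P] (h : HasHazard D P Λ lam) :
    (P.restrict {ω | D ω < ∞}).map (fun ω => (D ω).toReal) =
      (volume.restrict (Ioi 0)).withDensity fun w => ENNReal.ofReal (lam w * Real.exp (-Λ w)) := by
  have hm : Measurable fun ω => (D ω).toReal := h.measurable.ennreal_toReal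
  have := Measure.isProbabilityMeasure_map (μ := P) hm.aemeasurable
  have hgen : borel ℝ = MeasurableSpace.generateFrom (range Iio) := borel_eq_generateFrom_Iio ℝ
  refine Measure.ext_of_generateFrom_of_iUnion (range Iio) (fun n : ℕ => Iio (n : ℝ))
    (by rw [← hgen]; exact BorelSpace.measurable_eq) isPiSystem_Iio ?_ (fun n => ⟨_, rfl⟩)
    (fun n => ?_) ?_
  · exact eq_univ_of_forall fun x => mem_iUnion.2 (exists_nat_gt x)
  · rw [Measure.map_apply hm measurableSet_Iio]
    exact measure_ne_top _ _
  · rintro _ ⟨r, rfl⟩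
    rw [Measure.map_apply hm measurableSet_Iio, Measure.restrict_apply (hm measurableSet_Iio),
      withDensity_apply _ measurableSet_Iio, Measure.restrict_restrict measurableSet_Iio,
      inter_comm (Iio r), Ioi_inter_Iio]
    rcases le_total r 0 with hr | hr
    · rw [Ioo_eq_empty (not_lt.2 hr)]
      have : (fun ω => (D ω).toReal) ⁻¹' Iio r ∩ {ω | D ω < ∞} = ∅ := by
        ext ω
        simp only [mem_inter_iff, mem_preimage, mem_Iio, mem_empty_iff_false, iff_false, not_and]
        intro h1
        exact absurd (h1.trans_le hr) (not_lt.2 ENNReal.toReal_nonneg)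
      simp [this]
    · rw [h.lintegral_density hr, ← h.measure_lt r hr]
      congr 1
      ext ω
      simp only [mem_inter_iff, mem_preimage, mem_Iio, mem_ofPred_eq]
      constructor
      · rintro ⟨h1, h2⟩
        exact (ENNReal.lt_ofReal_iff_toReal_lt h2.ne).2 h1
      · intro h1
        have h2 := h1.trans ENNReal.ofReal_lt_top
        exact ⟨(ENNReal.lt_ofReal_iff_toReal_lt h2.ne).1 h1, h2⟩

lemma pathGain_diagonal_top {η H : ℝ} (hη : 0 < η) : pathGain η (diagonal ∞ H) = 0 := by
  simp [pathGain, diagonal, hη]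

lemma pathGain_diagonal {η H : ℝ} (d : ℝ≥0∞) (hd : d ≠ ∞) :
    pathGain η (diagonal d H) = (d.toReal ^ 2 + H ^ 2) ^ (-(η / 4)) := by
  rw [pathGain, diagonal, ← ENNReal.toReal_rpow, ← ENNReal.toReal_rpow,
    ENNReal.toReal_add (by finiteness) (by finiteness), ENNReal.toReal_pow,
    ENNReal.toReal_ofReal (sq_nonneg H), ← Real.rpow_mul (by positivity)]
  congr 1
  ring

lemma measurable_pathGain_diagonal (η H : ℝ) : Measurable fun d => pathGain η (diagonal d H) := by
  unfold pathGain diagonal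
  fun_prop

lemma pathGain_nonneg (η : ℝ) (R : ℝ≥0∞) : 0 ≤ pathGain η R := ENNReal.toReal_nonneg

lemma pathGain_diagonal_pos {η H : ℝ} (hH : 0 < H) {d : ℝ≥0∞} (hd : d ≠ ∞) :
    0 < pathGain η (diagonal d H) := by
  rw [pathGain_diagonal d hd]
  positivity

lemma pathGain_diagonal_le {η H : ℝ} (hη : 0 < η) (hH : 0 < H) (d : ℝ≥0∞) :
    pathGain η (diagonal d H) ≤ (H ^ 2) ^ (-(η / 4)) := by
  by_cases hd : d = ∞
  · rw [hd, pathGain_diagonal_top hη]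
    positivity
  · rw [pathGain_diagonal d hd]
    exact Real.rpow_le_rpow_of_nonpos (by positivity) (by nlinarith [sq_nonneg d.toReal])
      (by linarith)

/-- On `D = ∞` the gain is `0`, and so is its `k`-th power because `k ≠ 0`; the integral therefore
only sees the density of the finite part. -/
lemma HasHazard.integral_pathGain_pow [IsProbabilityMeasure P] (h : HasHazard D P Λ lam)
    {η H : ℝ} (hη : 0 < η) (hH : 0 < H) {k : ℕ} (hk : k ≠ 0) :
    ∫ ω, pathGain η (diagonal (D ω) H) ^ k ∂P =
      ∫ w in Ioi 0, (w ^ 2 + H ^ 2) ^ (-(k * η / 4)) * (lam w * Real.exp (-Λ w)) := by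
  have hmD : MeasurableSet {ω | D ω < ∞} := h.measurable measurableSet_Iio
  have hc := h.continuous_cumulative
  have hl := h.continuous
  rw [← setIntegral_eq_integral_of_forall_compl_eq_zero (s := {ω | D ω < ∞})]
  swap
  · intro ω hω
    have : D ω = ∞ := by simpa using hω
    rw [this, pathGain_diagonal_top hη, zero_pow hk]
  have e : ∀ ω ∈ {ω | D ω < ∞}, pathGain η (diagonal (D ω) H) ^ k =
      ((D ω).toReal ^ 2 + H ^ 2) ^ (-(k * η / 4)) := by
    intro ω hω
    rw [pathGain_diagonal _ (ne_of_lt hω), ← Real.rpow_natCast, ← Real.rpow_mul (by positivity)]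
    congr 1; ring
  rw [setIntegral_congr_fun hmD e]
  have hm : Measurable fun ω => (D ω).toReal := h.measurable.ennreal_toReal
  rw [← integral_map (μ := P.restrict {ω | D ω < ∞}) (φ := fun ω => (D ω).toReal)
    (f := fun w => (w ^ 2 + H ^ 2) ^ (-(k * η / 4))) hm.aemeasurable
    (Measurable.aestronglyMeasurable (by fun_prop)), h.map_toReal,
    integral_withDensity_eq_integral_toReal_smul (by fun_prop)
      (ae_of_all _ fun _ => ENNReal.ofReal_lt_top)]
  refine setIntegral_congr_fun measurableSet_Ioi fun w (hw : 0 < w) => ?_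
  have := h.nonneg w hw.le
  rw [ENNReal.toReal_ofReal (by positivity), smul_eq_mul, mul_comm]

end Hazard

/-! ### The distances to the HAPs -/

section Hap

variable {p : Params} {Ω : Type*} [MeasurableSpace Ω] {P : Measure Ω} {Φ : Ω → Set Plane}

lemma hapIntensity_ball (hp : p.Admissible) {r : ℝ} (hr : 0 ≤ r) :
    p.hapIntensity {x | ‖x‖ₑ < ENNReal.ofReal r} =
      ENNReal.ofReal (p.lamHAP * (Real.pi * r ^ 2)) := by
  have : {x : Plane | ‖x‖ₑ < ENNReal.ofReal r} = Metric.ball 0 r := by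
    ext x
    rw [mem_ofPred_eq, ← ofReal_norm, mem_ball_zero_iff, ENNReal.ofReal_lt_ofReal_iff']
    exact ⟨fun h => h.1, fun h => ⟨h, (norm_nonneg x).trans_lt h⟩⟩
  rw [Params.hapIntensity, this, Measure.smul_apply, EuclideanSpace.volume_ball_fin_two,
    smul_eq_mul, ENNReal.ofReal_mul hp.lamHAP_pos.le, ENNReal.ofReal_mul Real.pi_pos.le,
    ENNReal.ofReal_pow hr, mul_comm (ENNReal.ofReal Real.pi)]

lemma hasHazard_nearest [IsProbabilityMeasure P] (hp : p.Admissible)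
    (h : IsPoissonProcess Φ p.hapIntensity P) :
    HasHazard (fun ω => nearest (Φ ω)) P (fun r => p.lamHAP * (Real.pi * r ^ 2))
      (fun r => p.lamHAP * (Real.pi * (2 * r))) := by
  have hB : ∀ r, MeasurableSet {x : Plane | ‖x‖ₑ < r} := fun r =>
    measurableSet_lt measurable_enorm measurable_const
  have hD : ∀ r ω, nearest (Φ ω) < r ↔ (Φ ω ∩ {x : Plane | ‖x‖ₑ < r}).Nonempty := fun r ω =>
    nearest_lt_iff
  have hl := hp.lamHAP_pos
  refine ⟨measurable_of_nearest h hB hD, fun r hr => ?_, by simp, fun r => ?_, by fun_prop,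
    fun r hr => by positivity⟩
  · simp_rw [hD]
    have hb := hapIntensity_ball hp hr
    rw [h.measure_nonempty (hB _) (by rw [hb]; exact ENNReal.ofReal_ne_top), hb,
      ENNReal.toReal_ofReal (by positivity)]
  · exact (((hasDerivAt_pow 2 r).const_mul Real.pi).const_mul p.lamHAP).congr_deriv (by simp)

/-- The probability of a HAP within distance `n` is `1 - exp(-λ π n²)`, which tends to `1`. -/
lemma nearest_lt_top [IsProbabilityMeasure P] (hp : p.Admissible)
    (h : IsPoissonProcess Φ p.hapIntensity P) : ∀ᵐ ω ∂P, nearest (Φ ω) < ∞ := by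
  have hh := hasHazard_nearest hp h
  have hl := hp.lamHAP_pos
  refine (mem_ae_iff_prob_eq_one (hh.measurable measurableSet_Iio)).2 ?_
  refine le_antisymm prob_le_one (le_of_tendsto' (x := Filter.atTop)
    (f := fun n : ℕ => ENNReal.ofReal (1 - Real.exp (-(p.lamHAP * (Real.pi * (n : ℝ) ^ 2))))) ?_ ?_)
  · rw [← ENNReal.ofReal_one]
    refine ENNReal.tendsto_ofReal ?_
    have : Filter.Tendsto (fun n : ℕ => p.lamHAP * (Real.pi * (n : ℝ) ^ 2)) Filter.atTop
        Filter.atTop :=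
      (((Filter.tendsto_pow_atTop two_ne_zero).comp tendsto_natCast_atTop_atTop).const_mul_atTop
        Real.pi_pos).const_mul_atTop hl
    simpa using (Real.tendsto_exp_neg_atTop_nhds_zero.comp this).const_sub 1
  · intro n
    rw [← hh.measure_lt n n.cast_nonneg]
    exact measure_mono fun ω hω => lt_trans hω ENNReal.ofReal_lt_top

/-- The moments of the path gain of a link to the nearest HAP. -/
lemma integral_hapGain [IsProbabilityMeasure P] (hp : p.Admissible)
    (h : IsPoissonProcess Φ p.hapIntensity P) {η H : ℝ} (hη : 0 < η) (hH : 0 < H) {k : ℕ}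
    (hk : k ≠ 0) :
    ∫ ω, pathGain η (diagonal (nearest (Φ ω)) H) ^ k ∂P = p.hapMoment η H k := by
  rw [(hasHazard_nearest hp h).integral_pathGain_pow hη hH hk, Params.hapMoment, upperGamma]
  have hc : 0 < Real.pi * p.lamHAP := mul_pos Real.pi_pos hp.lamHAP_pos
  set c := Real.pi * p.lamHAP with hcdef
  -- The substitution `t = c (w² + H²)` turns the moment into an incomplete Gamma integral; its
  -- lower limit `c H²` is the value at `w = 0`.
  have himg : (fun w => c * (w ^ 2 + H ^ 2)) '' Ioi 0 = Ioi (H ^ 2 * p.lamHAP * Real.pi) := by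
    have e : H ^ 2 * p.lamHAP * Real.pi = c * H ^ 2 := by rw [hcdef]; ring
    rw [e]
    ext y
    constructor
    · rintro ⟨w, hw, rfl⟩
      have : 0 < w := hw
      exact mul_lt_mul_of_pos_left (by nlinarith) hc
    · intro (hy : c * H ^ 2 < y)
      have hpos : 0 < y / c - H ^ 2 := by
        rw [sub_pos, lt_div_iff₀ hc]; linarith
      refine ⟨√(y / c - H ^ 2), Real.sqrt_pos.2 hpos, ?_⟩
      simp only
      rw [Real.sq_sqrt hpos.le]
      field_simp
      ring
  have hderiv : ∀ w ∈ Ioi (0 : ℝ),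
      HasDerivWithinAt (fun w => c * (w ^ 2 + H ^ 2)) (c * (2 * w)) (Ioi 0) w := by
    intro w _
    exact ((((hasDerivAt_pow 2 w).add_const (H ^ 2)).const_mul c).congr_deriv
      (by simp)).hasDerivWithinAt
  have hinj : InjOn (fun w => c * (w ^ 2 + H ^ 2)) (Ioi (0 : ℝ)) := by
    intro x (hx : 0 < x) y (hy : 0 < y) hxy
    have := mul_left_cancel₀ hc.ne' hxy
    exact (pow_left_inj₀ hx.le hy.le two_ne_zero).1 (by linarith)
  rw [← himg, integral_image_eq_integral_abs_deriv_smul measurableSet_Ioi hderiv hinj,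
    ← integral_const_mul]
  refine setIntegral_congr_fun measurableSet_Ioi fun w (hw : 0 < w) => ?_
  have hs : 0 < w ^ 2 + H ^ 2 := by positivity
  have e1 : (1 - η * k / 4 - 1 : ℝ) = -(k * η / 4) := by ring
  have e2 : c ^ (η * k / 4) * c ^ (-(k * η / 4)) = 1 := by
    rw [← Real.rpow_add hc, show η * k / 4 + -(k * η / 4) = (0 : ℝ) by ring, Real.rpow_zero]
  have e3 : Real.exp (-(p.lamHAP * (Real.pi * w ^ 2))) =
      Real.exp (Real.pi * H ^ 2 * p.lamHAP) * Real.exp (-(c * (w ^ 2 + H ^ 2))) := by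
    rw [← Real.exp_add, hcdef]; congr 1; ring
  simp only [smul_eq_mul]
  rw [abs_of_pos (by positivity), e1, Real.mul_rpow hc.le hs.le, e3]
  linear_combination (-(w ^ 2 + H ^ 2) ^ (-(k * η / 4)) * c * 2 * w *
    (Real.exp (Real.pi * H ^ 2 * p.lamHAP) * Real.exp (-(c * (w ^ 2 + H ^ 2))))) * e2

end Hap

/-! ### The area swept by a rectangle along a segment -/

/-- The set is the closed `w / 2`-neighbourhood of the interval with endpoints `s y` and `s' y`. -/
lemma volume_thickened_interval {s s' : ℝ} (h : s ≤ s') (y : ℝ) {w : ℝ} (hw : 0 ≤ w) :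
    volume {b : ℝ | ∃ t ∈ Icc s s', |t * y - b| ≤ w / 2} =
      ENNReal.ofReal |y| * ENNReal.ofReal (s' - s) + ENNReal.ofReal w := by
  have key : {b : ℝ | ∃ t ∈ Icc s s', |t * y - b| ≤ w / 2} =
      Icc (min (s * y) (s' * y) - w / 2) (max (s * y) (s' * y) + w / 2) := by
    have himg : (fun t => t * y) '' Icc s s' = Icc (min (s * y) (s' * y)) (max (s * y) (s' * y)) := by
      rw [← uIcc_of_le h, image_mul_const_uIcc]; rfl
    ext b
    constructor
    · rintro ⟨t, ht, hb⟩
      have h1 : t * y ∈ Icc (min (s * y) (s' * y)) (max (s * y) (s' * y)) :=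
        himg ▸ mem_image_of_mem _ ht
      rw [abs_le] at hb
      exact ⟨by linarith [h1.1], by linarith [h1.2]⟩
    · rintro ⟨h1, h2⟩
      have hmm : min (s * y) (s' * y) ≤ max (s * y) (s' * y) := min_le_max
      -- The witness is the point of the interval nearest to `b`, obtained by clamping.
      have h3 : max (min (s * y) (s' * y)) (min (max (s * y) (s' * y)) b) ∈
          (fun t => t * y) '' Icc s s' := by
        rw [himg]
        exact ⟨le_max_left _ _, max_le hmm (min_le_left _ _)⟩
      obtain ⟨t, ht, hty⟩ := h3
      refine ⟨t, ht, ?_⟩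
      simp only at hty
      rw [hty, abs_le]
      generalize min (s * y) (s' * y) = m at *
      generalize max (s * y) (s' * y) = M at *
      grind
  rw [key, Real.volume_Icc, ← ENNReal.ofReal_mul (abs_nonneg y),
    ← ENNReal.ofReal_add (mul_nonneg (abs_nonneg y) (sub_nonneg.2 h)) hw]
  congr 1
  have : max (s * y) (s' * y) - min (s * y) (s' * y) = |y| * (s' - s) := by
    rw [max_sub_min_eq_abs, ← sub_mul, abs_mul, abs_of_nonneg (sub_nonneg.2 h), mul_comm]
  linarith

lemma isClosed_setOf_abs_le_and {X : Type*} [TopologicalSpace X] {f g : X → ℝ} {a b : X → ℝ}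
    (hf : Continuous f) (hg : Continuous g) (ha : Continuous a := by fun_prop)
    (hb : Continuous b := by fun_prop) :
    IsClosed {x | |f x| ≤ a x ∧ |g x| ≤ b x} :=
  IsClosed.inter (isClosed_le hf.abs ha) (isClosed_le hg.abs hb)

/-- The Minkowski sum of the segment from the origin to `y` and a centred `l × w` rectangle. -/
def sweep (y : ℝ × ℝ) (l w : ℝ) : Set (ℝ × ℝ) :=
  {c | ∃ t ∈ Icc (0 : ℝ) 1, |t * y.1 - c.1| ≤ l / 2 ∧ |t * y.2 - c.2| ≤ w / 2}

/-- It is the projection of a closed set along the compact factor `[0, 1]`. -/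
lemma isClosed_sweep (y : ℝ × ℝ) (l w : ℝ) : IsClosed (sweep y l w) := by
  have : sweep y l w = Prod.fst '' {q : (ℝ × ℝ) × Icc (0 : ℝ) 1 |
      |(q.2 : ℝ) * y.1 - q.1.1| ≤ l / 2 ∧ |(q.2 : ℝ) * y.2 - q.1.2| ≤ w / 2} := by
    ext c
    constructor
    · rintro ⟨t, ht, h⟩
      exact ⟨(c, ⟨t, ht⟩), h, rfl⟩
    · rintro ⟨⟨c', t⟩, h, rfl⟩
      exact ⟨t, t.2, h⟩
  rw [this]
  refine isClosedMap_fst_of_compactSpace _ ?_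
  exact isClosed_setOf_abs_le_and (by fun_prop) (by fun_prop)

/-- Slicing at first coordinate `a`: the times `t` compatible with `a` form an interval `T a`, so a
nonempty slice is an interval of length `|y.2| |T a| + w`. Integrating over `a`, the first part
gives `|y.2| l`, and the second gives `w` times the length `|y.1| + l` of the projection `Z`. -/
lemma volume_sweep (y : ℝ × ℝ) {l w : ℝ} (hl : 0 ≤ l) (hw : 0 ≤ w) :
    volume (sweep y l w) = ENNReal.ofReal |y.2| * ENNReal.ofReal l +
      ENNReal.ofReal w * (ENNReal.ofReal |y.1| + ENNReal.ofReal l) := by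
  set T : ℝ → Set ℝ := fun a => {t | t ∈ Icc (0 : ℝ) 1 ∧ |t * y.1 - a| ≤ l / 2} with hT
  set Z : Set ℝ := {a | ∃ t ∈ Icc (0 : ℝ) 1, |t * y.1 - a| ≤ l / 2} with hZ
  set G : Set (ℝ × ℝ) := {q | q.1 ∈ Icc (0 : ℝ) 1 ∧ |q.1 * y.1 - q.2| ≤ l / 2} with hG
  have hGm : MeasurableSet G :=
    (IsClosed.inter (isClosed_Icc.preimage continuous_fst)
      (isClosed_le (f := fun q : ℝ × ℝ => |q.1 * y.1 - q.2|) (g := fun _ => l / 2)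
        (by fun_prop) (by fun_prop))).measurableSet
  have hZm : MeasurableSet Z := by
    have : Z = Prod.snd '' {q : Icc (0 : ℝ) 1 × ℝ | |(q.1 : ℝ) * y.1 - q.2| ≤ l / 2} := by
      ext a
      constructor
      · rintro ⟨t, ht, h⟩
        exact ⟨(⟨t, ht⟩, a), h, rfl⟩
      · rintro ⟨⟨t, a'⟩, h, rfl⟩
        exact ⟨t, t.2, h⟩
    rw [this]
    exact (isClosedMap_snd_of_compactSpace _
      (isClosed_le (by fun_prop) (by fun_prop))).measurableSet
  have hslice : ∀ a, volume (Prod.mk a ⁻¹' sweep y l w) =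
      ENNReal.ofReal |y.2| * volume (T a) + Z.indicator (fun _ => ENNReal.ofReal w) a := by
    intro a
    have hs : Prod.mk a ⁻¹' sweep y l w = {b | ∃ t ∈ T a, |t * y.2 - b| ≤ w / 2} := by
      ext b
      simp only [sweep, hT, mem_preimage, mem_ofPred_eq, and_assoc]
    rw [hs]
    by_cases ha : a ∈ Z
    · obtain ⟨t₀, ht₀, hta⟩ := ha
      have hclosed : IsClosed (T a) :=
        isClosed_Icc.inter (isClosed_le (f := fun t : ℝ => |t * y.1 - a|) (g := fun _ => l / 2)
          (by fun_prop) (by fun_prop))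
      have hcompact : IsCompact (T a) := isCompact_Icc.of_isClosed_subset hclosed fun t ht => ht.1
      have hconn : (T a).OrdConnected := by
        refine ⟨fun t ht t' ht' u hu => ⟨⟨ht.1.1.trans hu.1, hu.2.trans ht'.1.2⟩, ?_⟩⟩
        have h1 := abs_le.1 ht.2
        have h2 := abs_le.1 ht'.2
        rw [abs_le]
        rcases le_total 0 y.1 with h | h
        · have := mul_le_mul_of_nonneg_right hu.1 h
          have := mul_le_mul_of_nonneg_right hu.2 h
          constructor <;> linarith
        · have := mul_le_mul_of_nonpos_right hu.1 h
          have := mul_le_mul_of_nonpos_right hu.2 h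
          constructor <;> linarith
      have hne : (T a).Nonempty := ⟨t₀, ht₀, hta⟩
      have hIcc := eq_Icc_of_connected_compact ⟨hne, hconn.isPreconnected⟩ hcompact
      have hle : sInf (T a) ≤ sSup (T a) := csInf_le_csSup hne hcompact.bddBelow hcompact.bddAbove
      rw [indicator_of_mem (show a ∈ Z from ⟨t₀, ht₀, hta⟩), hIcc, volume_thickened_interval hle _ hw,
        Real.volume_Icc]
    · have hempty : T a = ∅ := eq_empty_of_forall_notMem fun t ht => ha ⟨t, ht⟩
      simp [hempty, ha]
  have hTm : Measurable fun a => volume (T a) := measurable_measure_prodMk_right hGm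
  -- Exchange of the order of integration: for each `t` in `[0, 1]` the admissible `a` form an
  -- interval of length `l`.
  have hTi : ∫⁻ a, volume (T a) = ENNReal.ofReal l := by
    have h1 : (volume.prod volume : Measure (ℝ × ℝ)) G = ∫⁻ a, volume (T a) :=
      Measure.prod_apply_symm hGm
    have h2 : (volume.prod volume : Measure (ℝ × ℝ)) G = ∫⁻ t, volume (Prod.mk t ⁻¹' G) :=
      Measure.prod_apply hGm
    rw [← h1, h2]
    have h3 : ∀ t, volume (Prod.mk t ⁻¹' G) =
        (Icc (0 : ℝ) 1).indicator (fun _ => ENNReal.ofReal l) t := by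
      intro t
      by_cases ht : t ∈ Icc (0 : ℝ) 1
      · have : Prod.mk t ⁻¹' G = {b | ∃ u ∈ Icc t t, |u * y.1 - b| ≤ l / 2} := by
          ext b
          simp [hG, ht.1, ht.2]
        rw [this, volume_thickened_interval le_rfl _ hl, indicator_of_mem ht]
        simp
      · have : Prod.mk t ⁻¹' G = ∅ := eq_empty_of_forall_notMem fun b hb => ht hb.1
        rw [this, indicator_of_notMem ht, measure_empty]
    simp_rw [h3]
    rw [lintegral_indicator_const measurableSet_Icc, Real.volume_Icc]
    simp
  have hZv : volume Z = ENNReal.ofReal |y.1| + ENNReal.ofReal l := by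
    rw [hZ, volume_thickened_interval zero_le_one _ hl]; simp
  rw [Measure.volume_eq_prod, Measure.prod_apply (isClosed_sweep y l w).measurableSet]
  simp_rw [hslice]
  rw [lintegral_add_left (hTm.const_mul _), lintegral_const_mul _ hTm, hTi,
    lintegral_indicator_const hZm, hZv]

/-! ### Rotated coordinates -/

/-- Coordinates of a point with respect to the axes rotated by `θ`. -/
noncomputable def rotCoord (θ : ℝ) (c : Plane) : ℝ × ℝ :=
  (Real.cos θ * c 0 + Real.sin θ * c 1, -Real.sin θ * c 0 + Real.cos θ * c 1)

lemma measurePreserving_rotCoord (θ : ℝ) : MeasurePreserving (rotCoord θ) volume volume := by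
  set M : Matrix (Fin 2) (Fin 2) ℝ := !![Real.cos θ, Real.sin θ; -Real.sin θ, Real.cos θ] with hM
  have hdet : M.det = 1 := by
    rw [hM, Matrix.det_fin_two_of]
    linear_combination Real.cos_sq_add_sin_sq θ
  have h1 : MeasurePreserving (Matrix.toLin' M) volume volume := by
    refine ⟨(LinearMap.continuous_of_finiteDimensional _).measurable, ?_⟩
    rw [Real.map_matrix_volume_pi_eq_smul_volume_pi (by rw [hdet]; exact one_ne_zero), hdet]
    simp
  have h := ((volume_preserving_finTwoArrow ℝ).comp h1).comp
    (PiLp.volume_preserving_ofLp (Fin 2))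
  have e : rotCoord θ = (MeasurableEquiv.finTwoArrow ∘ Matrix.toLin' M) ∘ WithLp.ofLp := by
    refine funext fun c => Prod.ext ?_ ?_ <;>
    simp [rotCoord, hM, MeasurableEquiv.finTwoArrow, Matrix.toLin'_apply, Matrix.mulVec,
      dotProduct, Fin.sum_univ_two]
  rw [e]
  exact h

lemma exists_rotCoord_eq (x : Plane) : ∃ φ : ℝ, ∀ θ,
    rotCoord θ x = (‖x‖ * Real.cos (θ - φ), -(‖x‖ * Real.sin (θ - φ))) := by
  set z : ℂ := ⟨x 0, x 1⟩ with hz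
  have hn : ‖x‖ = ‖z‖ := by
    rw [EuclideanSpace.norm_eq, Complex.norm_eq_sqrt_sq_add_sq, Fin.sum_univ_two]
    simp [hz]
  refine ⟨z.arg, fun θ => ?_⟩
  have h0 : x 0 = ‖z‖ * Real.cos z.arg := by rw [Complex.norm_mul_cos_arg]
  have h1 : x 1 = ‖z‖ * Real.sin z.arg := by rw [Complex.norm_mul_sin_arg]
  rw [rotCoord, h0, h1, hn, Real.cos_sub, Real.sin_sub]
  ext <;> simp only <;> ring

/-- Periodicity removes the shift, and each half-period contributes `2`. -/
lemma integral_abs_sin_sub (φ : ℝ) : ∫ θ in (0 : ℝ)..2 * Real.pi, |Real.sin (θ - φ)| = 4 := by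
  have hper : Function.Periodic (fun θ => |Real.sin θ|) (2 * Real.pi) := fun θ => by simp
  have hi : ∀ a b : ℝ, IntervalIntegrable (fun θ => |Real.sin θ|) volume a b := fun a b =>
    Continuous.intervalIntegrable (by fun_prop) a b
  rw [intervalIntegral.integral_comp_sub_right (fun θ => |Real.sin θ|) φ,
    show 2 * Real.pi - φ = (0 - φ) + 2 * Real.pi by ring, hper.intervalIntegral_add_eq (0 - φ) 0,
    zero_add, ← intervalIntegral.integral_add_adjacent_intervals (hi 0 Real.pi) (hi Real.pi _)]
  have h1 : ∫ θ in (0 : ℝ)..Real.pi, |Real.sin θ| = 2 := by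
    rw [intervalIntegral.integral_congr (g := Real.sin)]
    · rw [integral_sin, Real.cos_zero, Real.cos_pi]; norm_num
    · intro θ hθ
      rw [uIcc_of_le Real.pi_pos.le] at hθ
      exact abs_of_nonneg (Real.sin_nonneg_of_mem_Icc hθ)
  have h2 : ∫ θ in Real.pi..2 * Real.pi, |Real.sin θ| = 2 := by
    have h := intervalIntegral.integral_comp_add_right (a := 0) (b := Real.pi)
      (fun θ => |Real.sin θ|) Real.pi
    rw [zero_add, ← two_mul] at h
    rw [← h, ← h1]
    simp
  rw [h1, h2]; norm_num

lemma lintegral_orientation {f : ℝ → ℝ} (hf : Continuous f) (h0 : ∀ θ, 0 ≤ f θ) :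
    ∫⁻ θ, ENNReal.ofReal (f θ) ∂(ProbabilityTheory.cond volume (Ioc 0 (2 * Real.pi))) =
      ENNReal.ofReal ((2 * Real.pi)⁻¹ * ∫ θ in (0 : ℝ)..2 * Real.pi, f θ) := by
  have hpi := Real.pi_pos
  rw [ProbabilityTheory.cond, lintegral_smul_measure, Real.volume_Ioc, sub_zero,
    ← ENNReal.ofReal_inv_of_pos (by positivity), smul_eq_mul,
    ENNReal.ofReal_mul (by positivity), intervalIntegral.integral_of_le (by positivity),
    ofReal_integral_eq_lintegral_ofReal]
  · exact (hf.integrableOn_Icc (a := 0) (b := 2 * Real.pi)).mono_set Ioc_subset_Icc_self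
  · exact ae_of_all _ h0

lemma continuous_rotCoord (x : Plane) : Continuous fun θ => rotCoord θ x := by
  unfold rotCoord
  fun_prop

/-- The constant `2 / π` is the mean `4 / (2 π)` of `|cos|` over a full turn. -/
lemma lintegral_abs_rotCoord_fst (x : Plane) :
    ∫⁻ θ, ENNReal.ofReal |(rotCoord θ x).1| ∂(ProbabilityTheory.cond volume (Ioc 0 (2 * Real.pi))) =
      ENNReal.ofReal (2 / Real.pi * ‖x‖) := by
  obtain ⟨φ, hφ⟩ := exists_rotCoord_eq x
  rw [lintegral_orientation (f := fun θ => |(rotCoord θ x).1|) (continuous_fst.comp (continuous_rotCoord x)).abs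
    (fun _ => abs_nonneg _)]
  simp_rw [hφ, abs_mul, abs_norm]
  have e : ∀ θ, Real.cos (θ - φ) = Real.sin (θ - (φ - Real.pi / 2)) := fun θ => by
    rw [← Real.sin_add_pi_div_two]; congr 1; ring
  simp_rw [e]
  rw [intervalIntegral.integral_const_mul, integral_abs_sin_sub]
  congr 1
  have := Real.pi_pos.ne'
  field_simp
  ring

lemma lintegral_abs_rotCoord_snd (x : Plane) :
    ∫⁻ θ, ENNReal.ofReal |(rotCoord θ x).2| ∂(ProbabilityTheory.cond volume (Ioc 0 (2 * Real.pi))) =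
      ENNReal.ofReal (2 / Real.pi * ‖x‖) := by
  obtain ⟨φ, hφ⟩ := exists_rotCoord_eq x
  rw [lintegral_orientation (f := fun θ => |(rotCoord θ x).2|) (continuous_snd.comp (continuous_rotCoord x)).abs
    (fun _ => abs_nonneg _)]
  simp_rw [hφ, abs_neg, abs_mul, abs_norm]
  rw [intervalIntegral.integral_const_mul, integral_abs_sin_sub]
  congr 1
  have := Real.pi_pos.ne'
  field_simp
  ring

/-! ### Visibility -/

/-- The buildings that block the segment from the origin to `x`. -/
def blocking (x : Plane) : Set Building := {b | ¬ Disjoint (footprint b) (segment ℝ 0 x)}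

lemma mem_blocking_iff {x : Plane} {b : Building} :
    b ∈ blocking x ↔ ∃ t ∈ Icc (0 : ℝ) 1, t • x ∈ footprint b := by
  rw [blocking, mem_ofPred_eq, not_disjoint_iff]
  constructor
  · rintro ⟨y, hy, hs⟩
    rw [segment_eq_image] at hs
    obtain ⟨t, ht, rfl⟩ := hs
    exact ⟨t, ht, by simpa using hy⟩
  · rintro ⟨t, ht, h⟩
    refine ⟨t • x, h, ?_⟩
    rw [segment_eq_image]
    exact ⟨t, ht, by simp⟩

lemma isClosed_blocking (x : Plane) : IsClosed (blocking x) := by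
  have : blocking x = Prod.fst '' {q : Building × Icc (0 : ℝ) 1 | (q.2 : ℝ) • x ∈ footprint q.1} := by
    ext b
    rw [mem_blocking_iff]
    constructor
    · rintro ⟨t, ht, h⟩
      exact ⟨(b, ⟨t, ht⟩), h, rfl⟩
    · rintro ⟨⟨b', t⟩, h, rfl⟩
      exact ⟨t, t.2, h⟩
  rw [this]
  refine isClosedMap_fst_of_compactSpace _ ?_
  exact isClosed_setOf_abs_le_and (by fun_prop) (by fun_prop)

/-- In axes parallel to the building, a centre blocks exactly when it lies in the sweep of the
rectangle along the segment. The rotation preserves area, so `volume_sweep` applies. -/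
lemma volume_blocking_slice (x : Plane) {l w : ℝ} (θ : ℝ) (hl : 0 ≤ l) (hw : 0 ≤ w) :
    volume ((fun c => ((c, l, w, θ) : Building)) ⁻¹' blocking x) =
      ENNReal.ofReal |(rotCoord θ x).2| * ENNReal.ofReal l +
        ENNReal.ofReal w * (ENNReal.ofReal |(rotCoord θ x).1| + ENNReal.ofReal l) := by
  rw [← volume_sweep _ hl hw, ← (measurePreserving_rotCoord θ).measure_preimage
    (isClosed_sweep _ l w).measurableSet.nullMeasurableSet]
  congr 1
  ext c
  rw [mem_preimage, mem_blocking_iff, mem_preimage, sweep, mem_ofPred_eq]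
  refine exists_congr fun t => and_congr_right fun _ => ?_
  rw [footprint, mem_ofPred_eq]
  simp only [rotCoord, PiLp.smul_apply, smul_eq_mul]
  refine Iff.of_eq ?_
  congr 3 <;> ring

section Intensity

variable {p : Params}

lemma Params.Admissible.meanLen_pos (hp : p.Admissible) : 0 < p.meanLen := by
  have := hp.lenLaw_prob
  refine (integral_pos_iff_support_of_nonneg_ae (hp.lenLaw_pos.mono fun x hx => hx.le)
    hp.lenLaw_integrable).2 ?_
  have h : Function.support (fun x : ℝ => x) ∈ ae p.lenLaw := hp.lenLaw_pos.mono fun x hx => hx.ne'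
  rw [measure_congr (Filter.eventuallyEq_univ.2 h), measure_univ]
  exact one_pos

lemma Params.Admissible.meanWid_pos (hp : p.Admissible) : 0 < p.meanWid := by
  have := hp.widLaw_prob
  refine (integral_pos_iff_support_of_nonneg_ae (hp.widLaw_pos.mono fun x hx => hx.le)
    hp.widLaw_integrable).2 ?_
  have h : Function.support (fun x : ℝ => x) ∈ ae p.widLaw := hp.widLaw_pos.mono fun x hx => hx.ne'
  rw [measure_congr (Filter.eventuallyEq_univ.2 h), measure_univ]
  exact one_pos

lemma Params.Admissible.upsilon_pos (hp : p.Admissible) : 0 < p.upsilon := by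
  have := hp.meanLen_pos
  have := hp.meanWid_pos
  have := hp.lamB_pos
  have := Real.pi_pos
  unfold Params.upsilon
  positivity

/-- Averaging the swept area over independent sides and orientation gives `(2/π) ‖x‖ (E[L] + E[W]) +
E[L] E[W]`; multiplication by `λ_B` produces `Υ ‖x‖ + p`. -/
lemma buildingIntensity_blocking (hp : p.Admissible) (x : Plane) :
    p.buildingIntensity (blocking x) = ENNReal.ofReal (p.upsilon * ‖x‖ + p.pB) := by
  have := hp.lenLaw_prob
  have := hp.widLaw_prob
  have hpi := Real.pi_pos
  have hθ : IsProbabilityMeasure (ProbabilityTheory.cond volume (Ioc 0 (2 * Real.pi))) := by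
    refine cond_isProbabilityMeasure_of_finite ?_ ?_ <;> simp [hpi, ENNReal.mul_eq_top]
  have hl0 := hp.meanLen_pos.le
  have hw0 := hp.meanWid_pos.le
  have hB0 := hp.lamB_pos.le
  rw [Params.buildingIntensity, Measure.smul_apply,
    Measure.prod_apply_symm (isClosed_blocking x).measurableSet]
  have hpos : ∀ᵐ m ∂(p.lenLaw.prod (p.widLaw.prod
      (ProbabilityTheory.cond volume (Ioc 0 (2 * Real.pi))))), 0 < m.1 ∧ 0 < m.2.1 := by
    refine (Measure.quasiMeasurePreserving_fst.ae hp.lenLaw_pos).and ?_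
    exact (Measure.quasiMeasurePreserving_fst.comp
      Measure.quasiMeasurePreserving_snd).ae hp.widLaw_pos
  rw [lintegral_congr_ae (hpos.mono fun m hm =>
    volume_blocking_slice x (l := m.1) (w := m.2.1) m.2.2 hm.1.le hm.2.le)]
  have hm1 : Measurable fun θ => (rotCoord θ x).1 :=
    (continuous_fst.comp (continuous_rotCoord x)).measurable
  have hm2 : Measurable fun θ => (rotCoord θ x).2 :=
    (continuous_snd.comp (continuous_rotCoord x)).measurable
  have hL : ∫⁻ l, ENNReal.ofReal l ∂p.lenLaw = ENNReal.ofReal p.meanLen :=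
    (ofReal_integral_eq_lintegral_ofReal hp.lenLaw_integrable
      (hp.lenLaw_pos.mono fun x hx => hx.le)).symm
  have hW : ∫⁻ w, ENNReal.ofReal w ∂p.widLaw = ENNReal.ofReal p.meanWid :=
    (ofReal_integral_eq_lintegral_ofReal hp.widLaw_integrable
      (hp.widLaw_pos.mono fun x hx => hx.le)).symm
  rw [lintegral_prod _ (by fun_prop)]
  have e1 : ∀ l, ∫⁻ m, (ENNReal.ofReal |(rotCoord m.2 x).2| * ENNReal.ofReal l +
      ENNReal.ofReal m.1 * (ENNReal.ofReal |(rotCoord m.2 x).1| + ENNReal.ofReal l))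
        ∂(p.widLaw.prod (ProbabilityTheory.cond volume (Ioc 0 (2 * Real.pi)))) =
      ENNReal.ofReal (2 / Real.pi * ‖x‖) * ENNReal.ofReal l +
      ENNReal.ofReal p.meanWid * (ENNReal.ofReal (2 / Real.pi * ‖x‖) + ENNReal.ofReal l) := by
    intro l
    rw [lintegral_prod _ (by fun_prop)]
    have e2 : ∀ w, ∫⁻ θ, (ENNReal.ofReal |(rotCoord θ x).2| * ENNReal.ofReal l +
        ENNReal.ofReal w * (ENNReal.ofReal |(rotCoord θ x).1| + ENNReal.ofReal l))
          ∂(ProbabilityTheory.cond volume (Ioc 0 (2 * Real.pi))) =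
        ENNReal.ofReal (2 / Real.pi * ‖x‖) * ENNReal.ofReal l +
        ENNReal.ofReal w * (ENNReal.ofReal (2 / Real.pi * ‖x‖) + ENNReal.ofReal l) := by
      intro w
      rw [lintegral_add_left (by fun_prop), lintegral_mul_const _ (by fun_prop),
        lintegral_const_mul _ (by fun_prop), lintegral_add_left (by fun_prop),
        lintegral_abs_rotCoord_fst, lintegral_abs_rotCoord_snd, lintegral_const, measure_univ,
        mul_one]
    simp_rw [e2]
    rw [lintegral_add_left (by fun_prop), lintegral_const, measure_univ, mul_one,
      lintegral_mul_const _ (by fun_prop), hW]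
  simp_rw [e1]
  rw [lintegral_add_left (by fun_prop), lintegral_const_mul _ (by fun_prop),
    lintegral_const_mul _ (by fun_prop), lintegral_add_left (by fun_prop), hL, lintegral_const,
    measure_univ, mul_one, smul_eq_mul]
  have hx : 0 ≤ 2 / Real.pi * ‖x‖ := by positivity
  rw [← ENNReal.ofReal_add hx hl0, ← ENNReal.ofReal_mul hx, ← ENNReal.ofReal_mul hw0,
    ← ENNReal.ofReal_add (by positivity) (by positivity), ← ENNReal.ofReal_mul hB0]
  congr 1
  rw [Params.upsilon, Params.pB]
  field_simp
  ring

end Intensity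

section Visible

variable {p : Params} {Ω : Type*} [MeasurableSpace Ω] {P : Measure Ω} {N : Network p Ω}

/-- The visibility probability in the Boolean model. -/
lemma visProb_eq (hp : p.Admissible) (h : IsPoissonProcess N.buildings p.buildingIntensity P)
    (x : Plane) : N.visProb P x = Real.exp (-(p.upsilon * ‖x‖ + p.pB)) := by
  have hset : {ω | ∀ b ∈ N.buildings ω, Disjoint (footprint b) (segment ℝ 0 x)} =
      {ω | N.buildings ω ∩ blocking x = ∅} := by
    ext ω
    simp [blocking, eq_empty_iff_forall_notMem]
  have hb := buildingIntensity_blocking hp x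
  have h0 : 0 ≤ p.upsilon * ‖x‖ + p.pB := by
    have := hp.upsilon_pos
    have := hp.meanLen_pos
    have := hp.meanWid_pos
    have := hp.lamB_pos
    unfold Params.pB
    positivity
  rw [Network.visProb, Measure.real, hset, h.measure_void (isClosed_blocking x).measurableSet
    (by rw [hb]; exact ENNReal.ofReal_ne_top), hb, ENNReal.toReal_ofReal h0,
    ENNReal.toReal_ofReal (Real.exp_pos _).le]

/-- Marked positions of the visible RISs at distance less than `r`. -/
def visibleWithin (p : Params) (r : ℝ≥0∞) : Set (Plane × ℝ) :=
  {z | ‖z.1‖ₑ < r ∧ z.2 ≤ Real.exp (-(p.upsilon * ‖z.1‖ + p.pB))}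

lemma measurableSet_visibleWithin (r : ℝ≥0∞) : MeasurableSet (visibleWithin p r) :=
  MeasurableSet.inter
    (measurableSet_lt (f := fun z : Plane × ℝ => ‖z.1‖ₑ) (by fun_prop) measurable_const)
    (measurableSet_le measurable_snd
      (g := fun z : Plane × ℝ => Real.exp (-(p.upsilon * ‖z.1‖ + p.pB))) (by fun_prop))

lemma integral_mul_exp_neg {a : ℝ} (ha : 0 < a) {r : ℝ} (hr : 0 ≤ r) :
    ∫ w in Ioo 0 r, w * Real.exp (-(a * w)) =
      (1 - (a * r + 1) * Real.exp (-(a * r))) / a ^ 2 := by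
  have hF : ∀ w : ℝ, HasDerivAt (fun w => (1 - (a * w + 1) * Real.exp (-(a * w))) / a ^ 2)
      (w * Real.exp (-(a * w))) w := by
    intro w
    have h1 : HasDerivAt (fun w => a * w) a w := by simpa using (hasDerivAt_id w).const_mul a
    have h2 : HasDerivAt (fun w => Real.exp (-(a * w))) (Real.exp (-(a * w)) * -a) w := h1.neg.exp
    refine (((h1.add_const 1).mul h2).const_sub 1 |>.div_const (a ^ 2)).congr_deriv ?_
    field_simp
    ring
  rw [restrict_Ioo_eq_restrict_Ioc, ← intervalIntegral.integral_of_le hr,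
    intervalIntegral.integral_eq_sub_of_hasDerivAt (fun w _ => hF w)
      (Continuous.intervalIntegrable (by fun_prop) _ _)]
  simp

/-- The admissible marks at `x` have length equal to the visibility probability, so the intensity is
its integral over the disc, computed in polar coordinates. -/
lemma risIntensity_visibleWithin (hp : p.Admissible) {r : ℝ} (hr : 0 ≤ r) :
    p.risIntensity (visibleWithin p (ENNReal.ofReal r)) =
      ENNReal.ofReal (2 * Real.pi * p.muRIS * (Real.exp (-p.pB) / p.upsilon ^ 2) *
        (1 - (p.upsilon * r + 1) * Real.exp (-(p.upsilon * r)))) := by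
  have hΥ := hp.upsilon_pos
  have hpB : 0 ≤ p.pB := by
    have := hp.meanLen_pos
    have := hp.meanWid_pos
    have := hp.lamB_pos
    unfold Params.pB
    positivity
  have hmu := hp.muRIS_pos
  rw [Params.risIntensity, Measure.smul_apply, Measure.prod_apply (measurableSet_visibleWithin _)]
  set f : ℝ → ℝ := (Iio r).indicator fun w => Real.exp (-(p.upsilon * w + p.pB)) with hf
  have hslice : ∀ x : Plane, (volume.restrict (Icc (0 : ℝ) 1))
      (Prod.mk x ⁻¹' visibleWithin p (ENNReal.ofReal r)) = ENNReal.ofReal (f ‖x‖) := by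
    intro x
    have hlt : ‖x‖ₑ < ENNReal.ofReal r ↔ ‖x‖ < r := by
      rw [← ofReal_norm, ENNReal.ofReal_lt_ofReal_iff']
      exact ⟨fun h => h.1, fun h => ⟨h, (norm_nonneg x).trans_lt h⟩⟩
    by_cases hx : ‖x‖ < r
    · have : Prod.mk x ⁻¹' visibleWithin p (ENNReal.ofReal r) =
          Iic (Real.exp (-(p.upsilon * ‖x‖ + p.pB))) := by
        ext m
        simp [visibleWithin, hlt, hx]
      -- The bound by `1` ensures that the mark interval `[0, 1]` does not truncate the threshold.
      have hle : Real.exp (-(p.upsilon * ‖x‖ + p.pB)) ≤ 1 := by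
        rw [Real.exp_le_one_iff]
        have : 0 ≤ p.upsilon * ‖x‖ := by positivity
        linarith
      rw [this, Measure.restrict_apply measurableSet_Iic, hf, indicator_of_mem (show ‖x‖ ∈ Iio r from hx)]
      have : Iic (Real.exp (-(p.upsilon * ‖x‖ + p.pB))) ∩ Icc 0 1 =
          Icc 0 (Real.exp (-(p.upsilon * ‖x‖ + p.pB))) := by
        ext m
        simp only [mem_inter_iff, mem_Iic, mem_Icc]
        constructor
        · rintro ⟨h1, h2, -⟩; exact ⟨h2, h1⟩
        · rintro ⟨h1, h2⟩; exact ⟨h2, h1, h2.trans hle⟩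
      rw [this, Real.volume_Icc, sub_zero]
    · have : Prod.mk x ⁻¹' visibleWithin p (ENNReal.ofReal r) = ∅ := by
        ext m
        simp [visibleWithin, hlt, hx]
      rw [this, measure_empty, hf, indicator_of_notMem (show ‖x‖ ∉ Iio r from hx),
        ENNReal.ofReal_zero]
  simp_rw [hslice]
  have hf0 : ∀ w, 0 ≤ f w := fun w => indicator_nonneg (fun _ _ => (Real.exp_pos _).le) _
  have hfm : Measurable f := Measurable.indicator (by fun_prop) measurableSet_Iio
  have hint : Integrable (fun x : Plane => f ‖x‖) := by
    have hb : (fun x : Plane => f ‖x‖) =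
        (Metric.ball 0 r).indicator fun x => Real.exp (-(p.upsilon * ‖x‖ + p.pB)) := by
      ext x
      simp [hf, indicator]
    rw [hb, integrable_indicator_iff Metric.isOpen_ball.measurableSet]
    refine (ContinuousOn.integrableOn_compact (isCompact_closedBall (0 : Plane) r)
      (Continuous.continuousOn (by fun_prop))).mono_set Metric.ball_subset_closedBall
  rw [← ofReal_integral_eq_lintegral_ofReal hint (ae_of_all _ fun x => hf0 _),
    integral_fun_norm_addHaar volume f, smul_eq_mul, ← ENNReal.ofReal_mul hmu.le]
  congr 1
  have hball : volume.real (Metric.ball (0 : Plane) 1) = Real.pi := by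
    rw [Measure.real, EuclideanSpace.volume_ball_fin_two]
    simp [Real.pi_pos.le]
  have hI : ∫ y in Ioi (0 : ℝ), y ^ (2 - 1) • f y =
      Real.exp (-p.pB) * ∫ w in Ioo 0 r, w * Real.exp (-(p.upsilon * w)) := by
    rw [← integral_const_mul, ← Ioi_inter_Iio, ← setIntegral_indicator measurableSet_Iio]
    refine setIntegral_congr_fun measurableSet_Ioi fun w _ => ?_
    simp only [hf, indicator, smul_eq_mul]
    split_ifs
    · rw [neg_add, Real.exp_add]; ring
    · simp
  rw [finrank_euclideanSpace_fin, hball, hI, integral_mul_exp_neg hΥ hr]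
  simp only [nsmul_eq_mul, smul_eq_mul]
  push_cast
  ring

/-- The law of the distance to the nearest visible RIS. -/
lemma hasHazard_distG [IsProbabilityMeasure P] (hp : p.Admissible)
    (hb : IsPoissonProcess N.buildings p.buildingIntensity P)
    (hr : IsPoissonProcess N.ris p.risIntensity P) :
    HasHazard (N.distG P) P
      (fun r => 2 * Real.pi * p.muRIS * (Real.exp (-p.pB) / p.upsilon ^ 2) *
        (1 - (p.upsilon * r + 1) * Real.exp (-(p.upsilon * r))))
      (fun r => 2 * Real.pi * p.muRIS * Real.exp (-p.pB) * (r * Real.exp (-(p.upsilon * r)))) := by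
  have hD : ∀ r ω, N.distG P ω < r ↔ (N.ris ω ∩ visibleWithin p r).Nonempty := by
    intro r ω
    rw [Network.distG, nearest_lt_iff]
    constructor
    · rintro ⟨x, ⟨m, hm, hv⟩, hx⟩
      -- The visibility threshold is deterministic, so thinning by marks amounts to testing the
      -- marked process against a fixed set.
      rw [visProb_eq hp hb] at hv
      exact ⟨(x, m), hm, hx, hv⟩
    · rintro ⟨⟨x, m⟩, hm, hx, hv⟩
      refine ⟨x, ⟨m, hm, ?_⟩, hx⟩
      rw [visProb_eq hp hb]
      exact hv
  have hΥ := hp.upsilon_pos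
  have hmu := hp.muRIS_pos
  have hpi := Real.pi_pos
  refine ⟨measurable_of_nearest hr measurableSet_visibleWithin hD, fun r h0 => ?_, by simp,
    fun r => ?_, by fun_prop, fun r h0 => by positivity⟩
  · simp_rw [hD]
    have hv := risIntensity_visibleWithin hp h0
    rw [hr.measure_nonempty (measurableSet_visibleWithin _)
      (by rw [hv]; exact ENNReal.ofReal_ne_top), hv, ENNReal.toReal_ofReal]
    have := integral_mul_exp_neg hΥ h0
    -- The sign of the cumulative hazard is read off from its integral form.
    have hn : 0 ≤ ∫ w in Ioo 0 r, w * Real.exp (-(p.upsilon * w)) :=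
      setIntegral_nonneg measurableSet_Ioo fun w hw => mul_nonneg hw.1.le (Real.exp_pos _).le
    rw [this, div_nonneg_iff] at hn
    have hn' : 0 ≤ 1 - (p.upsilon * r + 1) * Real.exp (-(p.upsilon * r)) := by
      rcases hn with h | h
      · exact h.1
      · exact absurd h.2 (not_le.2 (by positivity))
    positivity
  · have h1 : HasDerivAt (fun w => p.upsilon * w) p.upsilon r := by
      simpa using (hasDerivAt_id r).const_mul p.upsilon
    have h2 : HasDerivAt (fun w => Real.exp (-(p.upsilon * w)))
      (Real.exp (-(p.upsilon * r)) * -p.upsilon) r := h1.neg.exp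
    refine ((((h1.add_const 1).mul h2).const_sub 1).const_mul _).congr_deriv ?_
    field_simp
    ring

/-- The moments of the path gain of the link to the nearest visible RIS. -/
lemma integral_risGain [IsProbabilityMeasure P] (hp : p.Admissible)
    (hb : IsPoissonProcess N.buildings p.buildingIntensity P)
    (hr : IsPoissonProcess N.ris p.risIntensity P) {k : ℕ} (hk : k ≠ 0) :
    ∫ ω, pathGain p.expG (diagonal (N.distG P ω) p.heightRIS) ^ k ∂P = p.risMoment k := by
  rw [(hasHazard_distG hp hb hr).integral_pathGain_pow hp.expG_pos hp.heightRIS_pos hk,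
    Params.risMoment, ← integral_const_mul]
  refine setIntegral_congr_fun measurableSet_Ioi fun w _ => ?_
  rw [neg_add, Real.exp_add]
  ring

end Visible

/-! ### Products of independent random variables -/

section Independence

variable {Ω : Type*} [MeasurableSpace Ω] {P : Measure Ω} {X Y : Ω → ℝ}

/-- A product of `L²` functions is in general only `L¹`; independence makes `X² Y²` integrable. -/
lemma memLp_two_mul_of_indepFun (h : IndepFun X Y P) (hX : MemLp X 2 P) (hY : MemLp Y 2 P) :
    MemLp (fun ω => X ω * Y ω) 2 P := by
  have hm : AEStronglyMeasurable (fun ω => X ω * Y ω) P := hX.1.mul hY.1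
  refine (memLp_two_iff_integrable_sq hm).2 ?_
  have h2 : IndepFun (fun ω => X ω ^ 2) (fun ω => Y ω ^ 2) P :=
    h.comp (φ := fun x : ℝ => x ^ 2) (ψ := fun x : ℝ => x ^ 2) (by fun_prop) (by fun_prop)
  simp_rw [mul_pow]
  exact h2.integrable_mul hX.integrable_sq hY.integrable_sq

lemma integral_mul_of_indepFun (h : IndepFun X Y P) (hX : MemLp X 2 P) (hY : MemLp Y 2 P) :
    ∫ ω, X ω * Y ω ∂P = (∫ ω, X ω ∂P) * ∫ ω, Y ω ∂P :=
  h.integral_fun_mul_eq_mul_integral hX.1 hY.1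

lemma integral_mul_sq_of_indepFun (h : IndepFun X Y P) (hX : MemLp X 2 P) (hY : MemLp Y 2 P) :
    ∫ ω, (X ω * Y ω) ^ 2 ∂P = (∫ ω, X ω ^ 2 ∂P) * ∫ ω, Y ω ^ 2 ∂P := by
  have h2 : IndepFun (fun ω => X ω ^ 2) (fun ω => Y ω ^ 2) P :=
    h.comp (φ := fun x : ℝ => x ^ 2) (ψ := fun x : ℝ => x ^ 2) (by fun_prop) (by fun_prop)
  simp_rw [mul_pow]
  exact h2.integral_fun_mul_eq_mul_integral (hX.1.pow 2) (hY.1.pow 2)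

lemma variance_eq_integral_sq_sub [IsProbabilityMeasure P] (hX : MemLp X 2 P) :
    variance X P = ∫ ω, X ω ^ 2 ∂P - (∫ ω, X ω ∂P) ^ 2 := variance_eq_sub hX

/-- An affine function of `X` with independent random coefficients and nonvanishing slope has a
density if `X` does. -/
lemma map_add_mul_absolutelyContinuous [IsProbabilityMeasure P] {Y : Ω → ℝ × ℝ}
    (hX : Measurable X) (hY : Measurable Y) (h : IndepFun Y X P)
    (hac : P.map X ≪ volume) (h0 : ∀ᵐ ω ∂P, (Y ω).2 ≠ 0) :
    P.map (fun ω => (Y ω).1 + X ω * (Y ω).2) ≪ volume := by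
  have := Measure.isProbabilityMeasure_map (μ := P) hX.aemeasurable
  refine Measure.AbsolutelyContinuous.mk fun s hs hs0 => ?_
  have hF : Measurable fun z : (ℝ × ℝ) × ℝ => z.1.1 + z.2 * z.1.2 := by fun_prop
  have hmap : P.map (fun ω => (Y ω).1 + X ω * (Y ω).2) =
      ((P.map Y).prod (P.map X)).map fun z => z.1.1 + z.2 * z.1.2 := by
    rw [← (indepFun_iff_map_prod_eq_prod_map_map hY.aemeasurable hX.aemeasurable).1 h,
      Measure.map_map hF (hY.prodMk hX)]
    rfl
  rw [hmap, Measure.map_apply hF hs, Measure.measure_prod_null (hF hs)]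
  have h1 : ∀ᵐ y ∂P.map Y, y.2 ≠ 0 :=
    (ae_map_iff hY.aemeasurable (measurable_snd (measurableSet_singleton 0).compl)).2 h0
  filter_upwards [h1] with y hy
  refine hac ?_
  -- With the coefficients fixed, the preimage of a null set under an affine map of nonzero slope is
  -- null.
  have : Prod.mk y ⁻¹' ((fun z : (ℝ × ℝ) × ℝ => z.1.1 + z.2 * z.1.2) ⁻¹' s) =
      (· * y.2) ⁻¹' ((y.1 + ·) ⁻¹' s) := rfl
  rw [this, Real.volume_preimage_mul_right hy, measure_preimage_add, hs0, mul_zero]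

end Independence

/-! ### The amplitude as a function of independent variables -/

section Amplitude

variable {Ω : Type*} [MeasurableSpace Ω] {P : Measure Ω} {L : ℕ} {Z : Source L → Ω → ℝ}

/-- Sum of the amplitudes of the reflected paths. -/
def reflectedSum (Z : Source L → Ω → ℝ) (ω : Ω) : ℝ := ∑ l, Z (.q l) ω * Z (.g l) ω

/-- Amplitude of the reflected signal. -/
def reflected (Z : Source L → Ω → ℝ) (ω : Ω) : ℝ :=
  reflectedSum Z ω * (Z .distQ ω * Z .distG ω)

/-- Amplitude of the direct signal. -/
def direct (Z : Source L → Ω → ℝ) (ω : Ω) : ℝ := Z .u ω * Z .distU ω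

lemma measurable_reflected (hm : ∀ s, Measurable (Z s)) : Measurable (reflected Z) := by
  unfold reflected reflectedSum
  fun_prop

open Classical in
/-- The indices of the fading coefficients of the reflected paths. -/
noncomputable def pathSources (L : ℕ) : Finset (Source L) :=
  Finset.univ.image Source.q ∪ Finset.univ.image Source.g

lemma q_mem_pathSources (l : Fin L) : Source.q l ∈ pathSources L := by simp [pathSources]

lemma g_mem_pathSources (l : Fin L) : Source.g l ∈ pathSources L := by simp [pathSources]

lemma disjoint_pathSources {T : Finset (Source L)} (hq : ∀ l, Source.q l ∉ T)
    (hg : ∀ l, Source.g l ∉ T) : Disjoint (pathSources L) T := by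
  rw [Finset.disjoint_left]
  intro s hs
  simp only [pathSources, Finset.mem_union, Finset.mem_image, Finset.mem_univ, true_and] at hs
  rcases hs with ⟨l, rfl⟩ | ⟨l, rfl⟩
  · exact hq l
  · exact hg l

/-- The two functions depend on disjoint blocks of the independent family; the next two lemmas use
other groupings. -/
lemma indepFun_reflectedSum (hi : iIndepFun Z P) (hm : ∀ s, Measurable (Z s)) :
    IndepFun (reflectedSum Z) (fun ω => Z .distQ ω * Z .distG ω) P := by
  classical
  have h := hi.indepFun_finset (pathSources L) {.distQ, .distG}
    (disjoint_pathSources (by simp) (by simp)) hm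
  have hQ : Source.distQ ∈ ({.distQ, .distG} : Finset (Source L)) := by simp
  have hG : Source.distG ∈ ({.distQ, .distG} : Finset (Source L)) := by simp
  exact h.comp
    (φ := fun v => ∑ l, v ⟨.q l, q_mem_pathSources l⟩ * v ⟨.g l, g_mem_pathSources l⟩)
    (ψ := fun v => v ⟨.distQ, hQ⟩ * v ⟨.distG, hG⟩) (by fun_prop) (by fun_prop)

lemma indepFun_reflected_direct (hi : iIndepFun Z P) (hm : ∀ s, Measurable (Z s)) :
    IndepFun (reflected Z) (direct Z) P := by
  classical
  have h := hi.indepFun_finset (pathSources L ∪ {.distQ, .distG}) {.u, .distU}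
    (Finset.disjoint_union_left.2 ⟨disjoint_pathSources (by simp) (by simp), by simp⟩) hm
  have hQ : Source.distQ ∈ pathSources L ∪ {.distQ, .distG} := by simp
  have hG : Source.distG ∈ pathSources L ∪ {.distQ, .distG} := by simp
  have hu : Source.u ∈ ({.u, .distU} : Finset (Source L)) := by simp
  have hU : Source.distU ∈ ({.u, .distU} : Finset (Source L)) := by simp
  exact h.comp
    (φ := fun v => (∑ l, v ⟨.q l, Finset.mem_union_left _ (q_mem_pathSources l)⟩ *
      v ⟨.g l, Finset.mem_union_left _ (g_mem_pathSources l)⟩) * (v ⟨.distQ, hQ⟩ * v ⟨.distG, hG⟩))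
    (ψ := fun v => v ⟨.u, hu⟩ * v ⟨.distU, hU⟩) (by fun_prop) (by fun_prop)

/-- Here `u` is isolated from everything else, including its own path gain, so that the latter can
serve as a random slope. -/
lemma indepFun_reflected_u (hi : iIndepFun Z P) (hm : ∀ s, Measurable (Z s)) :
    IndepFun (fun ω => (reflected Z ω, Z .distU ω)) (Z .u) P := by
  classical
  have h := hi.indepFun_finset (pathSources L ∪ {.distQ, .distG, .distU}) {.u}
    (Finset.disjoint_union_left.2 ⟨disjoint_pathSources (by simp) (by simp), by simp⟩) hm
  have hQ : Source.distQ ∈ pathSources L ∪ {.distQ, .distG, .distU} := by simp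
  have hG : Source.distG ∈ pathSources L ∪ {.distQ, .distG, .distU} := by simp
  have hu : Source.u ∈ ({.u} : Finset (Source L)) := by simp
  have hU : Source.distU ∈ pathSources L ∪ {.distQ, .distG, .distU} := by simp
  have hψ : Measurable fun v : ({.u} : Finset (Source L)) → ℝ => v ⟨.u, hu⟩ :=
    measurable_pi_apply _
  refine IndepFun.comp (ψ := fun v : ({.u} : Finset (Source L)) → ℝ => v ⟨.u, hu⟩)
    (φ := fun v => ((∑ l, v ⟨.q l, Finset.mem_union_left _ (q_mem_pathSources l)⟩ *
      v ⟨.g l, Finset.mem_union_left _ (g_mem_pathSources l)⟩) *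
      (v ⟨.distQ, hQ⟩ * v ⟨.distG, hG⟩), v ⟨.distU, hU⟩)) h (by fun_prop) hψ

lemma memLp_path (hi : iIndepFun Z P) (hL : ∀ s, MemLp (Z s) 2 P) (l : Fin L) :
    MemLp (fun ω => Z (.q l) ω * Z (.g l) ω) 2 P :=
  memLp_two_mul_of_indepFun (hi.indepFun (by simp)) (hL _) (hL _)

lemma memLp_reflectedSum (hi : iIndepFun Z P) (hL : ∀ s, MemLp (Z s) 2 P) :
    MemLp (reflectedSum Z) 2 P :=
  memLp_finsetSum _ fun l _ => memLp_path hi hL l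

lemma memLp_distProd (hi : iIndepFun Z P) (hL : ∀ s, MemLp (Z s) 2 P) :
    MemLp (fun ω => Z .distQ ω * Z .distG ω) 2 P :=
  memLp_two_mul_of_indepFun (hi.indepFun (by simp)) (hL _) (hL _)

lemma memLp_reflected (hi : iIndepFun Z P) (hm : ∀ s, Measurable (Z s))
    (hL : ∀ s, MemLp (Z s) 2 P) : MemLp (reflected Z) 2 P :=
  memLp_two_mul_of_indepFun (indepFun_reflectedSum hi hm) (memLp_reflectedSum hi hL)
    (memLp_distProd hi hL)

lemma memLp_direct (hi : iIndepFun Z P) (hL : ∀ s, MemLp (Z s) 2 P) : MemLp (direct Z) 2 P :=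
  memLp_two_mul_of_indepFun (hi.indepFun (by simp)) (hL _) (hL _)

variable {mq mg : ℝ}

lemma integral_reflectedSum [IsProbabilityMeasure P] (hi : iIndepFun Z P)
    (hL : ∀ s, MemLp (Z s) 2 P)
    (hq : ∀ l, ∫ ω, Z (.q l) ω ∂P = mq) (hg : ∀ l, ∫ ω, Z (.g l) ω ∂P = mg) :
    ∫ ω, reflectedSum Z ω ∂P = L * (mq * mg) := by
  unfold reflectedSum
  rw [integral_finsetSum _ fun l _ => (memLp_path hi hL l).integrable one_le_two]
  simp_rw [fun l => integral_mul_of_indepFun (hi.indepFun (show Source.q l ≠ .g l by simp))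
    (hL _) (hL _), hq, hg]
  simp

/-- The paths are pairwise independent with variance `1 - (mq mg)²` each; adding the square of the
mean `L mq mg` to `L` times this variance gives the second moment. -/
lemma integral_reflectedSum_sq [IsProbabilityMeasure P] (hi : iIndepFun Z P)
    (hm : ∀ s, Measurable (Z s)) (hL : ∀ s, MemLp (Z s) 2 P)
    (hq : ∀ l, ∫ ω, Z (.q l) ω ∂P = mq) (hg : ∀ l, ∫ ω, Z (.g l) ω ∂P = mg)
    (hq2 : ∀ l, ∫ ω, Z (.q l) ω ^ 2 ∂P = 1) (hg2 : ∀ l, ∫ ω, Z (.g l) ω ^ 2 ∂P = 1) :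
    ∫ ω, reflectedSum Z ω ^ 2 ∂P = ((L : ℝ) ^ 2 - L) * mq ^ 2 * mg ^ 2 + L := by
  have hv := variance_eq_integral_sq_sub (memLp_reflectedSum hi hL)
  rw [integral_reflectedSum hi hL hq hg] at hv
  have hsum : reflectedSum Z = ∑ l, fun ω => Z (.q l) ω * Z (.g l) ω := by
    ext ω; simp [reflectedSum]
  have hvar : variance (reflectedSum Z) P = L * (1 - (mq * mg) ^ 2) := by
    rw [hsum, IndepFun.variance_sum (fun l _ => memLp_path hi hL l)]
    · have : ∀ l, variance (fun ω => Z (.q l) ω * Z (.g l) ω) P = 1 - (mq * mg) ^ 2 := by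
        intro l
        have hqg := hi.indepFun (show Source.q l ≠ .g l by simp)
        rw [variance_eq_integral_sq_sub (memLp_path hi hL l),
          integral_mul_of_indepFun hqg (hL _) (hL _),
          integral_mul_sq_of_indepFun hqg (hL _) (hL _), hq, hg, hq2, hg2, mul_one]
      simp only [this, Finset.sum_const, Finset.card_univ, Fintype.card_fin, nsmul_eq_mul]
    · intro l _ k _ hlk
      exact (hi.indepFun_prodMk_prodMk hm (.q l) (.g l) (.q k) (.g k) (by simpa using hlk)
        (by simp) (by simp) (by simpa using hlk)).comp
        (φ := fun v : ℝ × ℝ => v.1 * v.2) (ψ := fun v : ℝ × ℝ => v.1 * v.2)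
        (by fun_prop) (by fun_prop)
  linear_combination hvar - hv

end Amplitude

/-! ### The model -/

namespace Network

variable {p : Params} {Ω : Type*} [MeasurableSpace Ω] {P : Measure Ω} (N : Network p Ω)

/-- The independent real variables that determine `|A|`. -/
noncomputable def gain (P : Measure Ω) (s : Source p.L) (ω : Ω) : ℝ :=
  match s with
  | .q l => ‖N.q l ω‖
  | .g l => ‖N.g l ω‖
  | .u => ‖N.u ω‖
  | .distQ => pathGain p.expQ (diagonal (N.distQ ω) (p.heightHAP - p.heightRIS))
  | .distG => pathGain p.expG (diagonal (N.distG P ω) p.heightRIS)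
  | .distU => pathGain p.expU (diagonal (N.distU ω) p.heightHAP)

/-- The response `ζ l` cancels the phases of `q l` and `g l` and inserts that of `u`. All summands
are then nonnegative multiples of one unit number, so the norm is additive on them. -/
lemma absA_eq (ω : Ω) : N.absA P ω = reflected (N.gain P) ω + direct (N.gain P) ω := by
  have hζ : ∀ l, N.q l ω * N.g l ω * N.ζ l ω =
      ((‖N.q l ω‖ * ‖N.g l ω‖ : ℝ) : ℂ) * Complex.exp ((N.u ω).arg * Complex.I) := by
    intro l
    nth_rewrite 1 [← Complex.norm_mul_exp_arg_mul_I (N.q l ω),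
      ← Complex.norm_mul_exp_arg_mul_I (N.g l ω)]
    rw [Network.ζ]
    have : Complex.exp (Complex.I *
        (((N.u ω).arg - ((N.q l ω).arg + (N.g l ω).arg) : ℝ) : ℂ)) =
        Complex.exp ((N.u ω).arg * Complex.I) *
        ((Complex.exp ((N.q l ω).arg * Complex.I))⁻¹ *
          (Complex.exp ((N.g l ω).arg * Complex.I))⁻¹) := by
      rw [← Complex.exp_neg, ← Complex.exp_neg, ← Complex.exp_add, ← Complex.exp_add]
      congr 1
      push_cast
      ring
    rw [this]
    have h1 := Complex.exp_ne_zero ((N.q l ω).arg * Complex.I)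
    have h2 := Complex.exp_ne_zero ((N.g l ω).arg * Complex.I)
    push_cast
    field_simp
  have hA : N.A P ω = ((reflected (N.gain P) ω + direct (N.gain P) ω : ℝ) : ℂ) *
      Complex.exp ((N.u ω).arg * Complex.I) := by
    rw [Network.A]
    simp_rw [hζ]
    rw [← Finset.sum_mul]
    nth_rewrite 2 [← Complex.norm_mul_exp_arg_mul_I (N.u ω)]
    simp only [reflected, reflectedSum, direct, gain]
    push_cast
    ring
  have hnn : 0 ≤ reflected (N.gain P) ω + direct (N.gain P) ω := by
    simp only [reflected, reflectedSum, direct, gain]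
    have := pathGain_nonneg
    have h1 : ∀ l, 0 ≤ ‖N.q l ω‖ * ‖N.g l ω‖ := fun l => by positivity
    exact add_nonneg (mul_nonneg (Finset.sum_nonneg fun l _ => h1 l)
      (mul_nonneg (this _ _) (this _ _))) (mul_nonneg (norm_nonneg _) (this _ _))
  rw [absA, hA, norm_mul, Complex.norm_exp_ofReal_mul_I, mul_one, Complex.norm_real,
    Real.norm_of_nonneg hnn]

variable {N}

/-! ### Moments and density of `|A|` in the network model. -/

section Model

lemma measurable_gain [IsProbabilityMeasure P] (hp : p.Admissible) (hN : N.IsModel P) (s : Source p.L) :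
    Measurable (N.gain P s) := by
  cases s with
  | q l => exact (hN.q_measurable l).norm
  | g l => exact (hN.g_measurable l).norm
  | u => exact hN.u_measurable.norm
  | distQ =>
    exact (measurable_pathGain_diagonal _ _).comp
      (hasHazard_nearest hp hN.hapQ_poisson).measurable
  | distG =>
    exact (measurable_pathGain_diagonal _ _).comp
      (hasHazard_distG hp hN.buildings_poisson hN.ris_poisson).measurable
  | distU =>
    exact (measurable_pathGain_diagonal _ _).comp
      (hasHazard_nearest hp hN.hapU_poisson).measurable

/-- Each gain is a measurable function of its own source; `ENNReal.toReal` recovers the norm from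
the extended norm. -/
lemma iIndepFun_gain (hN : N.IsModel P) : iIndepFun (N.gain P) P := by
  let φ : Source p.L → ℝ≥0∞ → ℝ := fun s => match s with
    | .distQ => fun d => pathGain p.expQ (diagonal d (p.heightHAP - p.heightRIS))
    | .distG => fun d => pathGain p.expG (diagonal d p.heightRIS)
    | .distU => fun d => pathGain p.expU (diagonal d p.heightHAP)
    | _ => ENNReal.toReal
  have hφ : ∀ s, Measurable (φ s) := by
    intro s
    cases s with
    | q l => exact ENNReal.measurable_toReal
    | g l => exact ENNReal.measurable_toReal
    | u => exact ENNReal.measurable_toReal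
    | distQ => exact measurable_pathGain_diagonal _ _
    | distG => exact measurable_pathGain_diagonal _ _
    | distU => exact measurable_pathGain_diagonal _ _
  have e : N.gain P = fun s => φ s ∘ N.source P s := by
    funext s ω
    cases s <;> simp [gain, φ, source]
  rw [e]
  exact hN.indep.comp φ hφ

lemma memLp_of_map_eq_kappaMuMeasure {X : Ω → ℝ} {κ μ : ℝ} (hX : Measurable X) (hκ : 0 ≤ κ)
    (hμ : 0 < μ) (h : P.map X = kappaMuMeasure κ μ) : MemLp X 2 P := by
  refine (memLp_two_iff_integrable_sq hX.aestronglyMeasurable).2 ?_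
  have := integrable_sq_kappaMuMeasure hκ hμ
  rw [← h] at this
  exact this.comp_measurable hX

lemma integral_of_map_eq_kappaMuMeasure {X : Ω → ℝ} {κ μ : ℝ} (hX : Measurable X) (hκ : 0 ≤ κ)
    (hμ : 0 < μ) (h : P.map X = kappaMuMeasure κ μ) : ∫ ω, X ω ∂P = kappaMuMean κ μ := by
  rw [← integral_kappaMuMeasure hκ hμ, ← h, integral_map hX.aemeasurable (by fun_prop)]

lemma integral_sq_of_map_eq_kappaMuMeasure {X : Ω → ℝ} {κ μ : ℝ} (hX : Measurable X)
    (hκ : 0 ≤ κ) (hμ : 0 < μ) (h : P.map X = kappaMuMeasure κ μ) : ∫ ω, X ω ^ 2 ∂P = 1 := by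
  rw [← integral_sq_kappaMuMeasure hκ hμ, ← h, integral_map hX.aemeasurable (by fun_prop)]

/-- The positive vertical distance bounds the gain. -/
lemma memLp_pathGain_diagonal [IsProbabilityMeasure P] {D : Ω → ℝ≥0∞} (hD : Measurable D) {η H : ℝ} (hη : 0 < η)
    (hH : 0 < H) : MemLp (fun ω => pathGain η (diagonal (D ω) H)) 2 P :=
  MemLp.of_bound ((measurable_pathGain_diagonal η H).comp hD).aestronglyMeasurable _
    (ae_of_all _ fun ω => by
      rw [Real.norm_of_nonneg (pathGain_nonneg _ _)]
      exact pathGain_diagonal_le hη hH _)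

lemma memLp_gain [IsProbabilityMeasure P] (hp : p.Admissible) (hN : N.IsModel P) (s : Source p.L) :
    MemLp (N.gain P s) 2 P := by
  cases s with
  | q l =>
    exact memLp_of_map_eq_kappaMuMeasure (hN.q_measurable l).norm hp.κq_nonneg hp.μq_pos
      (hN.q_law l)
  | g l =>
    exact memLp_of_map_eq_kappaMuMeasure (hN.g_measurable l).norm hp.κg_nonneg hp.μg_pos
      (hN.g_law l)
  | u => exact memLp_of_map_eq_kappaMuMeasure hN.u_measurable.norm hp.κu_nonneg hp.μu_pos hN.u_law
  | distQ =>
    exact memLp_pathGain_diagonal (hasHazard_nearest hp hN.hapQ_poisson).measurable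
      hp.expQ_pos (sub_pos.2 hp.height_lt)
  | distG =>
    exact memLp_pathGain_diagonal
      (hasHazard_distG hp hN.buildings_poisson hN.ris_poisson).measurable
      hp.expG_pos hp.heightRIS_pos
  | distU =>
    exact memLp_pathGain_diagonal (hasHazard_nearest hp hN.hapU_poisson).measurable
      hp.expU_pos (hp.heightRIS_pos.trans hp.height_lt)

lemma memLp_absA [IsProbabilityMeasure P] (hp : p.Admissible) (hN : N.IsModel P) : MemLp (N.absA P) 2 P := by
  have hL := memLp_gain hp hN
  have hi := iIndepFun_gain hN
  rw [funext N.absA_eq]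
  exact (memLp_reflected hi (measurable_gain hp hN) hL).add (memLp_direct hi hL)

lemma integral_reflected [IsProbabilityMeasure P] (hp : p.Admissible) (hN : N.IsModel P) :
    ∫ ω, reflected (N.gain P) ω ∂P = p.P1 := by
  have hL := memLp_gain hp hN
  have hi := iIndepFun_gain hN
  have h1 := integral_hapGain hp hN.hapQ_poisson hp.expQ_pos (sub_pos.2 hp.height_lt) one_ne_zero
  have h2 := integral_risGain hp hN.buildings_poisson hN.ris_poisson one_ne_zero
  simp only [pow_one, Nat.cast_one] at h1 h2
  unfold reflected
  rw [integral_mul_of_indepFun (indepFun_reflectedSum hi (measurable_gain hp hN))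
      (memLp_reflectedSum hi hL) (memLp_distProd hi hL),
    integral_mul_of_indepFun (hi.indepFun (by simp)) (hL _) (hL _),
    integral_reflectedSum hi hL
      (fun l => integral_of_map_eq_kappaMuMeasure (hN.q_measurable l).norm hp.κq_nonneg hp.μq_pos
        (hN.q_law l))
      (fun l => integral_of_map_eq_kappaMuMeasure (hN.g_measurable l).norm hp.κg_nonneg hp.μg_pos
        (hN.g_law l)), Params.P1, ← h1, ← h2]
  simp only [gain, distQ]
  ring

lemma integral_reflected_sq [IsProbabilityMeasure P] (hp : p.Admissible) (hN : N.IsModel P) :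
    ∫ ω, reflected (N.gain P) ω ^ 2 ∂P =
      (((p.L : ℝ) ^ 2 - p.L) * kappaMuMean p.κq p.μq ^ 2 * kappaMuMean p.κg p.μg ^ 2 + p.L) *
        p.hapMoment p.expQ (p.heightHAP - p.heightRIS) 2 * p.risMoment 2 := by
  have hL := memLp_gain hp hN
  have hi := iIndepFun_gain hN
  have hm := measurable_gain hp hN
  have h1 := integral_hapGain hp hN.hapQ_poisson hp.expQ_pos (sub_pos.2 hp.height_lt) two_ne_zero
  have h2 := integral_risGain hp hN.buildings_poisson hN.ris_poisson two_ne_zero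
  simp only [Nat.cast_ofNat] at h1 h2
  unfold reflected
  rw [integral_mul_sq_of_indepFun (indepFun_reflectedSum hi hm)
      (memLp_reflectedSum hi hL) (memLp_distProd hi hL),
    integral_mul_sq_of_indepFun (hi.indepFun (by simp)) (hL _) (hL _),
    integral_reflectedSum_sq hi hm hL
      (fun l => integral_of_map_eq_kappaMuMeasure (hN.q_measurable l).norm hp.κq_nonneg hp.μq_pos
        (hN.q_law l))
      (fun l => integral_of_map_eq_kappaMuMeasure (hN.g_measurable l).norm hp.κg_nonneg hp.μg_pos
        (hN.g_law l))
      (fun l => integral_sq_of_map_eq_kappaMuMeasure (hN.q_measurable l).norm hp.κq_nonneg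
        hp.μq_pos (hN.q_law l))
      (fun l => integral_sq_of_map_eq_kappaMuMeasure (hN.g_measurable l).norm hp.κg_nonneg
        hp.μg_pos (hN.g_law l)), ← h1, ← h2]
  simp only [gain, distQ]
  ring

lemma integral_direct [IsProbabilityMeasure P] (hp : p.Admissible) (hN : N.IsModel P) :
    ∫ ω, direct (N.gain P) ω ∂P = p.P2 := by
  have hL := memLp_gain hp hN
  have hi := iIndepFun_gain hN
  have h1 := integral_hapGain hp hN.hapU_poisson hp.expU_pos
    (hp.heightRIS_pos.trans hp.height_lt) one_ne_zero
  have h2 := integral_of_map_eq_kappaMuMeasure hN.u_measurable.norm hp.κu_nonneg hp.μu_pos hN.u_law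
  simp only [pow_one, Nat.cast_one] at h1
  unfold direct
  rw [integral_mul_of_indepFun (hi.indepFun (by simp)) (hL _) (hL _), Params.P2, ← h1, ← h2]
  simp only [gain, distU]
  ring

lemma integral_direct_sq [IsProbabilityMeasure P] (hp : p.Admissible) (hN : N.IsModel P) :
    ∫ ω, direct (N.gain P) ω ^ 2 ∂P = p.hapMoment p.expU p.heightHAP 2 := by
  have hL := memLp_gain hp hN
  have hi := iIndepFun_gain hN
  have h1 := integral_hapGain hp hN.hapU_poisson hp.expU_pos
    (hp.heightRIS_pos.trans hp.height_lt) two_ne_zero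
  have h2 := integral_sq_of_map_eq_kappaMuMeasure hN.u_measurable.norm hp.κu_nonneg hp.μu_pos
    hN.u_law
  simp only [Nat.cast_ofNat] at h1
  unfold direct
  rw [integral_mul_sq_of_indepFun (hi.indepFun (by simp)) (hL _) (hL _), ← h1]
  simp only [gain, distU, h2, one_mul]

/-- The mean of `|A|`. -/
lemma integral_absA [IsProbabilityMeasure P] (hp : p.Admissible) (hN : N.IsModel P) :
    ∫ ω, N.absA P ω ∂P = p.P1 + p.P2 := by
  have hL := memLp_gain hp hN
  have hi := iIndepFun_gain hN
  rw [funext N.absA_eq, integral_add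
    ((memLp_reflected hi (measurable_gain hp hN) hL).integrable one_le_two)
    ((memLp_direct hi hL).integrable one_le_two), integral_reflected hp hN, integral_direct hp hN]

/-- The variance of `|A|`. -/
lemma variance_absA [IsProbabilityMeasure P] (hp : p.Admissible) (hN : N.IsModel P) :
    variance (N.absA P) P = p.varFormula := by
  have hL := memLp_gain hp hN
  have hi := iIndepFun_gain hN
  have hm := measurable_gain hp hN
  have hR := memLp_reflected hi hm hL
  have hD := memLp_direct hi hL
  rw [funext N.absA_eq, (indepFun_reflected_direct hi hm).variance_fun_add hR hD,
    variance_eq_integral_sq_sub hR, variance_eq_integral_sq_sub hD, integral_reflected hp hN,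
    integral_direct hp hN, integral_reflected_sq hp hN, integral_direct_sq hp hN,
    Params.varFormula]

lemma measurable_absA [IsProbabilityMeasure P] (hp : p.Admissible) (hN : N.IsModel P) : Measurable (N.absA P) := by
  have hm := measurable_gain hp hN
  rw [funext N.absA_eq]
  exact (measurable_reflected hm).add ((hm _).mul (hm _))

/-- Only the direct link is used: its slope is positive because a HAP almost surely exists. The
reflected amplitude may have an atom at `0`, which does no harm. -/
lemma hasPDF_absA [IsProbabilityMeasure P] (hp : p.Admissible) (hN : N.IsModel P) : HasPDF (N.absA P) P := by
  have hm := measurable_gain hp hN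
  have hi := iIndepFun_gain hN
  refine (Real.hasPDF_iff_of_aemeasurable (measurable_absA hp hN).aemeasurable).2 ?_
  rw [funext N.absA_eq]
  refine map_add_mul_absolutelyContinuous (X := N.gain P .u)
    (Y := fun ω => (reflected (N.gain P) ω, N.gain P .distU ω)) (hm _)
    ((measurable_reflected hm).prodMk (hm _)) (indepFun_reflected_u hi hm) ?_ ?_
  · have : P.map (N.gain P .u) = kappaMuMeasure p.κu p.μu := hN.u_law
    rw [this]
    exact (withDensity_absolutelyContinuous _ _).trans Measure.absolutelyContinuous_restrict
  · filter_upwards [nearest_lt_top hp hN.hapU_poisson] with ω hω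
    exact (pathGain_diagonal_pos (hp.heightRIS_pos.trans hp.height_lt) hω.ne).ne'

end Model

end Network

/-! ### Laguerre polynomials of low degree -/

lemma laguerre_zero {a : ℝ} (ha : 0 < a) (x : ℝ) : laguerre 0 (a - 1) x = 1 := by
  have := (Real.Gamma_pos_of_pos ha).ne'
  simp [laguerre, this]

lemma laguerre_one {a : ℝ} (ha : 0 < a) (x : ℝ) : laguerre 1 (a - 1) x = a - x := by
  have hG := (Real.Gamma_pos_of_pos ha).ne'
  have e0 : (0 : ℝ) + (a - 1) + 1 = a := by ring
  have e1 : (1 : ℝ) + (a - 1) + 1 = a + 1 := by ring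
  simp only [laguerre, Finset.sum_range_succ, Finset.sum_range_zero, Nat.cast_zero, Nat.cast_one,
    e0, e1, Real.Gamma_add_one ha.ne']
  norm_num [Nat.factorial]
  field_simp
  ring

lemma laguerre_two {a : ℝ} (ha : 0 < a) (x : ℝ) :
    laguerre 2 (a - 1) x = a * (a + 1) / 2 - (a + 1) * x + x ^ 2 / 2 := by
  have hG := (Real.Gamma_pos_of_pos ha).ne'
  have e0 : (0 : ℝ) + (a - 1) + 1 = a := by ring
  have e1 : (1 : ℝ) + (a - 1) + 1 = a + 1 := by ring
  have e2 : (2 : ℝ) + (a - 1) + 1 = a + 1 + 1 := by ring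
  have ha1 : a + 1 ≠ 0 := by positivity
  simp only [laguerre, Finset.sum_range_succ, Finset.sum_range_zero, Nat.cast_zero, Nat.cast_one,
    Nat.cast_ofNat, e0, e1, e2, Real.Gamma_add_one ha.ne', Real.Gamma_add_one ha1]
  norm_num [Nat.factorial]
  field_simp
  ring

section Coefficients

variable {Ω : Type*} [MeasurableSpace Ω] {P : Measure Ω} [IsProbabilityMeasure P] {X : Ω → ℝ}
  {α β : ℝ}

lemma laguerreCoeff_zero (hα : 0 < α) : laguerreCoeff P X α β 0 = 1 := by
  have := (Real.Gamma_pos_of_pos hα).ne'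
  simp [laguerreCoeff, laguerre_zero hα, this]

lemma laguerreCoeff_one (hα : 0 < α) (hβ : 0 < β) (hX : Integrable X P)
    (hmean : ∫ ω, X ω ∂P = α * β) : laguerreCoeff P X α β 1 = 0 := by
  have h : ∫ ω, laguerre 1 (α - 1) (X ω / β) ∂P = 0 := by
    simp_rw [laguerre_one hα]
    rw [integral_sub (integrable_const _) (hX.div_const β), integral_div, hmean]
    simp [hβ.ne']
  rw [laguerreCoeff, h, mul_zero]

/-- With mean `α β` and second moment `α (α + 1) β²`, the expectation of the quadratic Laguerre
polynomial cancels. -/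
lemma laguerreCoeff_two (hα : 0 < α) (hβ : 0 < β) (hX : MemLp X 2 P)
    (hmean : ∫ ω, X ω ∂P = α * β) (hvar : variance X P = α * β ^ 2) :
    laguerreCoeff P X α β 2 = 0 := by
  have hX1 := hX.integrable one_le_two
  have hX2 := hX.integrable_sq
  have hsq : ∫ ω, X ω ^ 2 ∂P = α * (α + 1) * β ^ 2 := by
    rw [variance_eq_integral_sq_sub hX, hmean] at hvar
    linear_combination hvar
  have h : ∫ ω, laguerre 2 (α - 1) (X ω / β) ∂P = 0 := by
    simp_rw [laguerre_two hα, div_pow]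
    have hi : Integrable (fun ω => α * (α + 1) / 2 - (α + 1) * (X ω / β)) P :=
      (integrable_const _).sub ((hX1.div_const β).const_mul _)
    rw [integral_add hi ((hX2.div_const _).div_const 2),
      integral_sub (integrable_const _) ((hX1.div_const β).const_mul _), integral_const_mul,
      integral_div, integral_div, integral_div, integral_div, hmean, hsq]
    simp
    field_simp
    ring
  rw [laguerreCoeff, h, mul_zero]

end Coefficients

/-! ### The approximating density -/

lemma snrApprox_eq {ρ α β x : ℝ} (hρ : 0 < ρ) (hβ : 0 < β) (hx : 0 < x) :
    snrApprox ρ α β x = 1 / (2 * √(ρ * x)) *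
      (√(x / ρ) ^ (α - 1) / (β ^ α * Real.Gamma α) * Real.exp (-(√(x / ρ) / β))) := by
  have e1 : √(x / (β ^ 2 * ρ)) = √(x / ρ) / β := by
    rw [mul_comm, ← div_div, Real.sqrt_div (by positivity), Real.sqrt_sq hβ.le]
  -- One factor of exponent `-1/2` in each of `ρ` and `x` is the Jacobian; the remaining powers form
  -- the Gamma density at `√(x / ρ)`.
  have e2 : ρ ^ (-(α / 2)) * x ^ ((α - 2) / 2) = (√(ρ * x))⁻¹ * √(x / ρ) ^ (α - 1) := by
    rw [Real.sqrt_eq_rpow, Real.sqrt_eq_rpow, ← Real.rpow_mul (by positivity),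
      Real.mul_rpow hρ.le hx.le, Real.div_rpow hx.le hρ.le, mul_inv, ← Real.rpow_neg hρ.le,
      ← Real.rpow_neg hx.le, div_eq_mul_inv (x ^ _), ← Real.rpow_neg hρ.le,
      show ρ ^ (-(α / 2)) = ρ ^ (-(1 / 2 : ℝ)) * ρ ^ (-(1 / 2 * (α - 1))) by
        rw [← Real.rpow_add hρ]; congr 1; ring,
      show x ^ ((α - 2) / 2) = x ^ (-(1 / 2 : ℝ)) * x ^ (1 / 2 * (α - 1)) by
        rw [← Real.rpow_add hx]; congr 1; ring]
    ring
  rw [snrApprox, e1, mul_assoc (1 / _), e2]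
  simp only [mul_inv, div_eq_mul_inv]
  ring

/-- `gammaMeasure` takes a rate, so scale `β` appears as `β⁻¹`. -/
lemma map_gammaMeasure_mul_sq {ρ α β : ℝ} (hρ : 0 < ρ) (hβ : 0 < β) :
    (gammaMeasure α β⁻¹).map (fun y => ρ * y ^ 2) =
      (volume.restrict (Ioi (0 : ℝ))).withDensity
        fun x => ENNReal.ofReal (snrApprox ρ α β x) := by
  rw [gammaMeasure_eq_restrict, map_mul_sq_withDensity hρ]
  refine withDensity_congr_ae ?_
  filter_upwards [ae_restrict_mem measurableSet_Ioi] with x (hx : 0 < x)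
  rw [← ENNReal.ofReal_mul (by positivity), snrApprox_eq hρ hβ hx, Real.inv_rpow hβ.le]
  congr 2
  rw [inv_mul_eq_div]
  ring

/-! ### The density of a scaled square -/

/-- Negative values are excluded by the sign of `X`, and the value `0` by absolute continuity. -/
lemma map_eq_withDensity_Ioi_pdf {Ω : Type*} [MeasurableSpace Ω] {P : Measure Ω} {X : Ω → ℝ}
    (hX : HasPDF X P) (h0 : ∀ ω, 0 ≤ X ω) :
    P.map X = (volume.restrict (Ioi 0)).withDensity (pdf X P volume) := by
  have hm := HasPDF.aemeasurable X P volume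
  have hpos : ∀ᵐ y ∂P.map X, y ∈ Ioi (0 : ℝ) := by
    have h1 : ∀ᵐ y ∂P.map X, y ∈ Ici (0 : ℝ) :=
      (ae_map_iff hm measurableSet_Ici).2 (ae_of_all _ h0)
    have h2 : ∀ᵐ y ∂P.map X, y ≠ 0 :=
      hX.absolutelyContinuous'.ae_le
        (by simp [ae_iff] : ∀ᵐ y : ℝ, y ≠ 0)
    filter_upwards [h1, h2] with y hy hy'
    exact lt_of_le_of_ne hy hy'.symm
  rw [← Measure.restrict_eq_self_of_ae_mem hpos, map_eq_withDensity_pdf X P volume,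
    restrict_withDensity measurableSet_Ioi]

/-- The density of `c X ^ 2` for a nonnegative random variable `X` with a density. -/
lemma hasPDF_mul_sq {Ω : Type*} [MeasurableSpace Ω] {P : Measure Ω} {X : Ω → ℝ} {c : ℝ}
    (hc : 0 < c) (hX : HasPDF X P) (h0 : ∀ ω, 0 ≤ X ω) :
    HasPDF (fun ω => c * X ω ^ 2) P ∧ ∀ᵐ x ∂(volume.restrict (Ioi (0 : ℝ))),
      pdf (fun ω => c * X ω ^ 2) P volume x =
        ENNReal.ofReal (1 / (2 * √(c * x))) * pdf X P volume (√(x / c)) := by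
  have hm := HasPDF.aemeasurable X P volume
  have hpdf := measurable_pdf X P volume
  set g : ℝ → ℝ≥0∞ := fun x =>
    ENNReal.ofReal (1 / (2 * √(c * x))) * pdf X P volume (√(x / c)) with hg
  have hgm : Measurable g :=
    (by fun_prop : Measurable fun x => ENNReal.ofReal (1 / (2 * √(c * x)))).mul
      (hpdf.comp (by fun_prop))
  have hgi : Measurable ((Ioi (0 : ℝ)).indicator g) := hgm.indicator measurableSet_Ioi
  have hmap : P.map (fun ω => c * X ω ^ 2) = volume.withDensity ((Ioi (0 : ℝ)).indicator g) := by
    rw [withDensity_indicator measurableSet_Ioi, ← map_mul_sq_withDensity hc,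
      ← map_eq_withDensity_Ioi_pdf hX h0, AEMeasurable.map_map_of_aemeasurable (by fun_prop) hm]
    rfl
  have hY : HasPDF (fun ω => c * X ω ^ 2) P :=
    hasPDF_of_map_eq_withDensity (by fun_prop) _ hgi.aemeasurable hmap
  refine ⟨hY, ?_⟩
  have := (pdf.eq_of_map_eq_withDensity' _ hgi.aemeasurable).1 hmap
  filter_upwards [ae_restrict_of_ae this, ae_restrict_mem measurableSet_Ioi] with x h1 h2
  rw [h1, indicator_of_mem h2]

/-- A square-integrable random variable with a density has positive variance. -/
lemma variance_pos_of_hasPDF {Ω : Type*} [MeasurableSpace Ω] {P : Measure Ω}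
    [IsProbabilityMeasure P] {X : Ω → ℝ} (hX : HasPDF X P) (h2 : MemLp X 2 P) :
    0 < variance X P := by
  refine (variance_nonneg X P).lt_of_ne' fun h => ?_
  -- Zero variance would make `X` almost surely constant, an atom that a density forbids.
  have h1 := ae_eq_integral_of_variance_eq_zero h2 h
  have hm := HasPDF.aemeasurable X P volume
  have h3 : ∀ᵐ y ∂P.map X, y ≠ ∫ ω, X ω ∂P :=
    hX.absolutelyContinuous'.ae_le
      (by simp [ae_iff] : ∀ᵐ y : ℝ, y ≠ ∫ ω, X ω ∂P)
  have h4 := ae_of_ae_map hm h3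
  obtain ⟨ω, hω, hω'⟩ := (h1.and h4).exists
  exact hω' hω

lemma integral_pos_of_hasPDF {Ω : Type*} [MeasurableSpace Ω] {P : Measure Ω}
    [IsProbabilityMeasure P] {X : Ω → ℝ} (hX : HasPDF X P) (h1 : Integrable X P)
    (h0 : ∀ ω, 0 ≤ X ω) : 0 < ∫ ω, X ω ∂P := by
  refine (integral_nonneg h0).lt_of_ne' fun h => ?_
  have h2 := (integral_eq_zero_iff_of_nonneg h0 h1).1 h
  have hm := HasPDF.aemeasurable X P volume
  have h3 : ∀ᵐ y ∂P.map X, y ≠ 0 :=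
    hX.absolutelyContinuous'.ae_le
      (by simp [ae_iff] : ∀ᵐ y : ℝ, y ≠ 0)
  obtain ⟨ω, hω, hω'⟩ := (h2.and (ae_of_ae_map hm h3)).exists
  exact hω' hω

end HapRis

theorem mainTheorem3 {Ω : Type*} [MeasurableSpace Ω] (P : Measure Ω) [IsProbabilityMeasure P]
    (p : HapRis.Params) (hp : p.Admissible) (N : HapRis.Network p Ω) (hN : N.IsModel P) :
    -- the mean and the variance of the amplitude of the combined channel response
    MemLp (N.absA P) 2 P ∧
    ∫ ω, N.absA P ω ∂P = p.P1 + p.P2 ∧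
    variance (N.absA P) P = p.varFormula ∧
    0 < ∫ ω, N.absA P ω ∂P ∧
    0 < variance (N.absA P) P ∧
    -- the densities of `|A|` and of the SNR, and the relation between them
    HasPDF (N.absA P) P ∧
    HasPDF (N.snr P) P ∧
    (∀ᵐ x ∂(volume.restrict (Set.Ioi (0 : ℝ))),
      pdf (N.snr P) P volume x =
        ENNReal.ofReal (1 / (2 * √(p.ρ₀ * x))) * pdf (N.absA P) P volume (√(x / p.ρ₀))) ∧
    -- the approximating density
    ∀ α β : ℝ,
      α = (∫ ω, N.absA P ω ∂P) ^ 2 / variance (N.absA P) P →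
      β = variance (N.absA P) P / ∫ ω, N.absA P ω ∂P →
      -- the Gamma law with shape `α` and scale `β` has the mean and the variance of `|A|`
      ∫ y, y ∂(gammaMeasure α β⁻¹) = ∫ ω, N.absA P ω ∂P ∧
      variance id (gammaMeasure α β⁻¹) = variance (N.absA P) P ∧
      -- its density is the first term of the Laguerre series of `|A|`, and the next two vanish
      (∀ y, 0 < y → HapRis.laguerreTerm P (N.absA P) α β 0 y =
        y ^ (α - 1) / (β ^ α * Real.Gamma α) * Real.exp (-(y / β))) ∧
      (∀ y, HapRis.laguerreTerm P (N.absA P) α β 1 y = 0) ∧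
      (∀ y, HapRis.laguerreTerm P (N.absA P) α β 2 y = 0) ∧
      -- the approximating SNR density is obtained from it by the above relation
      (∀ x, 0 < x → HapRis.snrApprox p.ρ₀ α β x =
        1 / (2 * √(p.ρ₀ * x)) * HapRis.laguerreTerm P (N.absA P) α β 0 (√(x / p.ρ₀))) ∧
      -- and it is the density of `ρ₀ Y ^ 2` for `Y` with that Gamma law
      (gammaMeasure α β⁻¹).map (fun y => p.ρ₀ * y ^ 2) =
        (volume.restrict (Set.Ioi (0 : ℝ))).withDensity
          (fun x => ENNReal.ofReal (HapRis.snrApprox p.ρ₀ α β x)) := by 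
  have hmem := HapRis.Network.memLp_absA hp hN
  have hmean := HapRis.Network.integral_absA hp hN
  have hvar := HapRis.Network.variance_absA hp hN
  have hpdf := HapRis.Network.hasPDF_absA hp hN
  have h0 : ∀ ω, 0 ≤ N.absA P ω := fun ω => norm_nonneg _
  have hE := HapRis.integral_pos_of_hasPDF hpdf (hmem.integrable one_le_two) h0
  have hV := HapRis.variance_pos_of_hasPDF hpdf hmem
  have hρ : 0 < p.ρ₀ := div_pos hp.Es_pos hp.N0_pos
  obtain ⟨hsnr, hrel⟩ := HapRis.hasPDF_mul_sq hρ hpdf h0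
  refine ⟨hmem, hmean, hvar, hE, hV, hpdf, hsnr, hrel, ?_⟩
  intro α β hα hβ
  have hα0 : 0 < α := hα ▸ by positivity
  have hβ0 : 0 < β := hβ ▸ by positivity
  -- Inverting the definitions of `α` and `β` gives mean `α β` and variance `α β²`; these two
  -- identities drive both the Gamma matching and the vanishing terms.
  have hm : ∫ ω, N.absA P ω ∂P = α * β := by
    rw [hα, hβ]; field_simp
  have hv : variance (N.absA P) P = α * β ^ 2 := by
    rw [hα, hβ]; field_simp
  have hterm : ∀ y, HapRis.laguerreTerm P (N.absA P) α β 0 y =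
      y ^ (α - 1) / (β ^ α * Real.Gamma α) * Real.exp (-(y / β)) := fun y => by
    rw [HapRis.laguerreTerm, HapRis.laguerreCoeff_zero hα0, HapRis.laguerre_zero hα0, mul_one,
      mul_one]
  refine ⟨?_, ?_, fun y _ => hterm y, fun y => ?_, fun y => ?_, fun x hx => ?_,
    HapRis.map_gammaMeasure_mul_sq hρ hβ0⟩
  · rw [HapRis.integral_gammaMeasure hα0 (inv_pos.2 hβ0), hm, div_inv_eq_mul]
  · rw [HapRis.variance_gammaMeasure hα0 (inv_pos.2 hβ0), hv, inv_pow, div_inv_eq_mul]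
  · rw [HapRis.laguerreTerm, HapRis.laguerreCoeff_one hα0 hβ0 (hmem.integrable one_le_two) hm,
      zero_mul, mul_zero]
  · rw [HapRis.laguerreTerm, HapRis.laguerreCoeff_two hα0 hβ0 hmem hm hv, zero_mul, mul_zero]
  · rw [hterm, HapRis.snrApprox_eq hρ hβ0 hx]
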